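/- **Definitions.** A *branched 2-complex* $X$ (not necessarily connected) consists of a graph $X_{(1)}$ (the 1-skeleton, with vertex set $V_X$ and edge set $E_X$), a non-empty set $F_X$ of faces, each attached along an immersion (a locally injective combinatorial map) of a subdivided circle to $X_{(1)}$, and a map $\mathrm{Area}:F_X\to\mathbb{Z}_{>0}$. For finite $X$, $\mathrm{Area}(X)$ is the sum of the areas of the faces. A *branched morphism* $\phi:Y\to X$ sends vertices to vertices and edges to edges homeomorphically, and faces to faces by maps modelled on $z\mapsto z^m$, with $m=m_\phi(f)\ge 1$, such that $\mathrm{Area}(f)=m_\phi(f)\,\mathrm{Area}(\phi(f))$ for each face $f$ of $Y$. It is a *branched immersion* if it is injective on the links of vertices, and a *branched covering* if it maps the link of each vertex $v$ bijectively to the link of $\phi(v)$. A branched covering is *finite-sheeted* if the fibre over every vertex of the target is finite and non-empty (if the target is connected, all these fibres have the same cardinality, the degree). The *folding* of $\phi:Y\to X$ is its factorisation $Y\xrightarrow{\phi_0}\bar Y\xrightarrow{\bar\phi}X$, unique up to isomorphism, in which $\bar\phi$ is a branched immersion and $\phi_0$ is surjective, induces a bijection on connected components and is surjective on fundamental groups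 of 1-skeleta. The map $\phi$ is *essential* if $\phi_0$ is a homotopy equivalence on 1-skeleta and restricts to a homeomorphism between the unions of the interiors of the faces; it is an *essential equivalence* if, moreover, $\bar\phi$ is an isomorphism. A complex is *visibly irreducible* if (i) every vertex of the 1-skeleton has valence at least 2, (ii) the link of every vertex is connected, (iii) no edge is hit exactly once by the attaching maps of the faces, and (iv) no link of a vertex has a cut vertex. A finite complex $X$ is *irreducible* if there is an essential equivalence $X'\to X$ with $X'$ finite and visibly irreducible. A finite complex is a *surface* if the link of every vertex is a circle. For finite $X$ let $$\kappa(X)=\frac{\mathrm{Area}(X)+\chi(X_{(1)})}{\mathrm{Area}(X)},\qquad \chi(X_{(1)})=\#V_X-\#E_X .$$ Let $\rho_+(X)$ and $\rho_-(X)$ be the supremum and the infimum, in $[-\infty,\infty]$, of $\kappa(Y)$ over all finite irreducible branched 2-complexes $Y$ that admit an essential map $Y\to X$, and let $\sigma_+(X)$ and $\sigma_-(X)$ be the supremum and the infimum of $\kappa(Y)$ over all branched 2-complexes $Y$ that are surfaces and admit an essential map $Y\to X$. (By convention $\sup\varnothing=-\infty$ and $\inf\varnothing=+\infty$.) **Proposition.**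 If $X'\to X$ is a finite-sheeted branched covering of finite, irreducible branched 2-complexes, then $$\rho_+(X')=\rho_+(X),\quad \rho_-(X')=\rho_-(X),\quad \sigma_+(X')=\sigma_+(X),\quad \sigma_-(X')=\sigma_-(X).$$ -/

import Mathlib

universe u

/-- A graph in the sense of Serre: `E` is the set of oriented edges, `inv` reverses the
orientation, and `src e` is the initial vertex of `e`. -/
structure SerreGraph where
  V : Type u
  E : Type u
  src : E → V
  inv : E → E
  inv_inv : ∀ e, inv (inv e) = e
  inv_ne : ∀ e, inv e ≠ e

namespace SerreGraph

/-- The terminal vertex of an oriented edge. -/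
def tgt (G : SerreGraph.{u}) (e : G.E) : G.V := G.src (G.inv e)

/-- `G.IsWalk v p w`: the list `p` of oriented edges is an edge path from `v` to `w`. -/
inductive IsWalk (G : SerreGraph.{u}) : G.V → List G.E → G.V → Prop
  | nil (v : G.V) : IsWalk G v [] v
  | cons (e : G.E) {p : List G.E} {w : G.V} :
      IsWalk G (G.tgt e) p w → IsWalk G (G.src e) (e :: p) w

/-- Two vertices lie in the same component. -/
def Joined (G : SerreGraph.{u}) (v w : G.V) : Prop := ∃ p, G.IsWalk v p w

/-- Elementary homotopy of edge paths: delete a backtrack. -/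
inductive Backtrack (G : SerreGraph.{u}) : List G.E → List G.E → Prop
  | del (p q : List G.E) (e : G.E) : Backtrack G (p ++ e :: G.inv e :: q) (p ++ q)

/-- Homotopy of edge paths relative to the endpoints. -/
def Homotopic (G : SerreGraph.{u}) : List G.E → List G.E → Prop :=
  Relation.EqvGen G.Backtrack

/-- Morphisms of graphs: vertices go to vertices, edges go to edges. -/
structure Hom (G H : SerreGraph.{u}) where
  onV : G.V → H.V
  onE : G.E → H.E
  map_src : ∀ e, onV (G.src e) = H.src (onE e)
  map_inv : ∀ e, onE (G.inv e) = H.inv (onE e)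

namespace Hom

variable {G H : SerreGraph.{u}}

/-- No two components are mapped into the same component. -/
def InjectiveOnComponents (g : Hom G H) : Prop :=
  ∀ v w, H.Joined (g.onV v) (g.onV w) → G.Joined v w

/-- Every component of the target meets the image. -/
def SurjectiveOnComponents (g : Hom G H) : Prop :=
  ∀ w, ∃ v, H.Joined (g.onV v) w

/-- The induced maps of fundamental groups, at all base points, are injective. -/
def PiOneInjective (g : Hom G H) : Prop :=
  ∀ v p q, G.IsWalk v p v → G.IsWalk v q v →
    H.Homotopic (p.map g.onE) (q.map g.onE) → G.Homotopic p q

/-- The induced maps of fundamental groups, at all base points, are surjective. -/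
def PiOneSurjective (g : Hom G H) : Prop :=
  ∀ v q, H.IsWalk (g.onV v) q (g.onV v) →
    ∃ p, G.IsWalk v p v ∧ H.Homotopic (p.map g.onE) q

/-- A homotopy equivalence of graphs: a bijection on components which induces isomorphisms of
fundamental groups at all base points. -/
structure IsHomotopyEquiv (g : Hom G H) : Prop where
  components_injective : g.InjectiveOnComponents
  components_surjective : g.SurjectiveOnComponents
  piOne_injective : g.PiOneInjective
  piOne_surjective : g.PiOneSurjective

end Hom

end SerreGraph

/-- A branched 2-complex, not necessarily connected or finite.  The underlying graph is the
1-skeleton and `F` is the set of faces.  The boundary of a face is a subdivided circle which is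
immersed in the 1-skeleton.  The circles are given by their oriented edges, here called sides:
`rev d` is `d` with the opposite orientation, and `opp d` is the other side that starts at the
point of the circle at which `d` starts (so the side that follows `d` is `opp (rev d)`).
Both involutions are free, by `bdry_rev` and `bdry_opp_ne`, so that the sides of
one face, which form a finite orbit, are exactly the oriented edges of a circle. -/
structure BranchedComplex extends SerreGraph.{u} where
  F : Type u
  D : Type u
  face : D → F
  rev : D → D
  opp : D → D
  bdry : D → E
  rev_rev : ∀ d, rev (rev d) = d
  opp_opp : ∀ d, opp (opp d) = d
  bdry_rev : ∀ d, bdry (rev d) = inv (bdry d)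
  src_bdry_opp : ∀ d, src (bdry (opp d)) = src (bdry d)
  /-- The attaching map does not backtrack. -/
  bdry_opp_ne : ∀ d, bdry (opp d) ≠ bdry d
  face_surjective : Function.Surjective face
  face_rev : ∀ d, face (rev d) = face d
  face_opp : ∀ d, face (opp d) = face d
  /-- The boundary of a face is connected. -/
  face_connected : ∀ d d', face d = face d' →
    Relation.ReflTransGen (fun a b => b = rev a ∨ b = opp a) d d'
  face_finite : ∀ f, Finite {d // face d = f}
  area : F → ℕ
  area_pos : ∀ f, 0 < area f
  /-- The total area is positive. -/
  nonempty_F : Nonempty F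

namespace BranchedComplex

/-- Finite complexes. -/
structure IsFinite (X : BranchedComplex.{u}) : Prop where
  finite_V : Finite X.V
  finite_E : Finite X.E
  finite_F : Finite X.F

/-- The number of oriented sides of a face, which is twice the length of its boundary. -/
noncomputable def numSides (X : BranchedComplex.{u}) (f : X.F) : ℕ :=
  Nat.card {d // X.face d = f}

/-- Branched morphisms.  On a face `f` the map is modelled on `z ↦ z ^ m` with `m = mult f`, so
that the boundary circle of `f` covers that of its image `m` times, and area is respected. -/
@[ext]
structure Hom (Y X : BranchedComplex.{u}) extends
    SerreGraph.Hom Y.toSerreGraph X.toSerreGraph where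
  onF : Y.F → X.F
  onD : Y.D → X.D
  mult : Y.F → ℕ
  map_face : ∀ d, onF (Y.face d) = X.face (onD d)
  map_rev : ∀ d, onD (Y.rev d) = X.rev (onD d)
  map_opp : ∀ d, onD (Y.opp d) = X.opp (onD d)
  map_bdry : ∀ d, onE (Y.bdry d) = X.bdry (onD d)
  numSides_eq : ∀ f, Y.numSides f = mult f * X.numSides (onF f)
  area_eq : ∀ f, Y.area f = mult f * X.area (onF f)

namespace Hom

variable {X Y Z : BranchedComplex.{u}}

/-- Composition of branched morphisms. -/
def comp (ψ : Hom Z X) (φ : Hom Y Z) : Hom Y X where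
  onV v := ψ.onV (φ.onV v)
  onE e := ψ.onE (φ.onE e)
  map_src e := by rw [φ.map_src, ψ.map_src]
  map_inv e := by rw [φ.map_inv, ψ.map_inv]
  onF f := ψ.onF (φ.onF f)
  onD d := ψ.onD (φ.onD d)
  mult f := φ.mult f * ψ.mult (φ.onF f)
  map_face d := by rw [φ.map_face, ψ.map_face]
  map_rev d := by rw [φ.map_rev, ψ.map_rev]
  map_opp d := by rw [φ.map_opp, ψ.map_opp]
  map_bdry d := by rw [φ.map_bdry, ψ.map_bdry]
  numSides_eq f := by rw [φ.numSides_eq, ψ.numSides_eq, mul_assoc]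
  area_eq f := by rw [φ.area_eq, ψ.area_eq, mul_assoc]

/-- Isomorphisms of branched 2-complexes. -/
structure IsIso (φ : Hom Y X) : Prop where
  bijective_onV : Function.Bijective φ.onV
  bijective_onE : Function.Bijective φ.onE
  bijective_onF : Function.Bijective φ.onF
  bijective_onD : Function.Bijective φ.onD

/-- A branched immersion is injective on the links of vertices.  The vertices of the link of `v`
are the oriented edges that start at `v`, and its (oriented) edges, the corners of faces at `v`,
are the sides that start at `v`. -/
structure IsBranchedImmersion (φ : Hom Y X) : Prop where
  injective_edges : ∀ v, Set.InjOn φ.onE {e | Y.src e = v}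
  injective_corners : ∀ v, Set.InjOn φ.onD {d | Y.src (Y.bdry d) = v}

/-- A branched covering is bijective on the links of vertices. -/
structure IsBranchedCovering (φ : Hom Y X) : Prop where
  bijective_edges : ∀ v, Set.BijOn φ.onE {e | Y.src e = v} {e | X.src e = φ.onV v}
  bijective_corners : ∀ v,
    Set.BijOn φ.onD {d | Y.src (Y.bdry d) = v} {d | X.src (X.bdry d) = φ.onV v}

/-- A branched covering is finite-sheeted if the fibre over every vertex is finite and non-empty
(for connected `X` its cardinality is the degree). -/
structure IsFiniteSheetedBranchedCovering (φ : Hom Y X) : Prop extends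
    IsBranchedCovering φ where
  fibre_finite : ∀ v, (φ.onV ⁻¹' {v}).Finite
  fibre_nonempty : ∀ v, (φ.onV ⁻¹' {v}).Nonempty

/-- `φ = ψ ∘ φ₀` is the folding factorisation of `φ`: the map `φ₀` is surjective, does not
identify components and is surjective on fundamental groups of 1-skeleta, and `ψ` is a branched
immersion.  This determines the factorisation up to isomorphism. -/
structure IsFolding (φ : Hom Y X) (φ₀ : Hom Y Z) (ψ : Hom Z X) : Prop where
  factors : ψ.comp φ₀ = φ
  surjective_onV : Function.Surjective φ₀.onV
  surjective_onE : Function.Surjective φ₀.onE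
  surjective_onF : Function.Surjective φ₀.onF
  components_injective : φ₀.toHom.InjectiveOnComponents
  piOne_surjective : φ₀.toHom.PiOneSurjective
  immersion : ψ.IsBranchedImmersion

/-- The map is a homotopy equivalence on 1-skeleta and a homeomorphism on (the union of) the
interiors of the faces. -/
structure PreservesSkeletonAndFaces (φ₀ : Hom Y Z) : Prop where
  homotopyEquiv : φ₀.toHom.IsHomotopyEquiv
  bijective_onF : Function.Bijective φ₀.onF
  mult_eq_one : ∀ f, φ₀.mult f = 1

/-- Essential maps. -/
def IsEssential (φ : Hom Y X) : Prop :=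
  ∃ (Z : BranchedComplex.{u}) (φ₀ : Hom Y Z) (ψ : Hom Z X),
    φ.IsFolding φ₀ ψ ∧ φ₀.PreservesSkeletonAndFaces

/-- Essential equivalences. -/
def IsEssentialEquiv (φ : Hom Y X) : Prop :=
  ∃ (Z : BranchedComplex.{u}) (φ₀ : Hom Y Z) (ψ : Hom Z X),
    φ.IsFolding φ₀ ψ ∧ φ₀.PreservesSkeletonAndFaces ∧ ψ.IsIso

end Hom

variable (X : BranchedComplex.{u})

/-- Adjacency in the link of a vertex: the link vertices `e` and `e'` are joined by a corner. -/
def LinkAdj (e e' : X.E) : Prop := ∃ d, X.bdry d = e ∧ X.bdry (X.opp d) = e'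

/-- The link of `v` is connected (or empty). -/
def LinkPreconnected (v : X.V) : Prop :=
  ∀ e e', X.src e = v → X.src e' = v → Relation.ReflTransGen X.LinkAdj e e'

/-- The 1-skeleton has a vertex of valence 0 or 1. -/
def HasVertexOfValenceLeOne : Prop := ∃ v, {e | X.src e = v}.Subsingleton

/-- Some vertex is locally separating, that is, its link is disconnected. -/
def HasLocallySeparatingVertex : Prop := ∃ v, ¬ X.LinkPreconnected v

/-- Some edge is hit exactly once by the boundaries of the faces. -/
def HasFreeFace : Prop := ∃ e, ∃! d, X.bdry d = e

/-- The vertex `e` of the link of `src e` is a cut vertex: its removal leaves two vertices of the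
link in different components. -/
def IsLinkCutVertex (e : X.E) : Prop :=
  ∃ e₁ e₂, X.src e₁ = X.src e ∧ X.src e₂ = X.src e ∧ e₁ ≠ e ∧ e₂ ≠ e ∧
    ¬ Relation.ReflTransGen (fun a b => X.LinkAdj a b ∧ a ≠ e ∧ b ≠ e) e₁ e₂

/-- Some link has a cut vertex, so that the complex can be unfolded there. -/
def HasLinkCutVertex : Prop := ∃ e, X.IsLinkCutVertex e

/-- Visibly irreducible complexes. -/
def IsVisiblyIrreducible : Prop :=
  ¬ X.HasVertexOfValenceLeOne ∧ ¬ X.HasLocallySeparatingVertex ∧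
    ¬ X.HasFreeFace ∧ ¬ X.HasLinkCutVertex

/-- Irreducible complexes. -/
def IsIrreducible : Prop :=
  ∃ (X' : BranchedComplex.{u}) (φ : Hom X' X),
    X'.IsFinite ∧ X'.IsVisiblyIrreducible ∧ φ.IsEssentialEquiv

/-- Closed surfaces: the complex is finite and the link of every vertex is a circle, that is, a
non-empty connected graph all of whose vertices have valence 2. -/
structure IsSurface : Prop where
  finite : X.IsFinite
  link_nonempty : ∀ v, ∃ e, X.src e = v
  link_connected : ∀ v, X.LinkPreconnected v
  link_valence : ∀ e, {d | X.bdry d = e}.ncard = 2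

/-- The total area of a finite complex. -/
noncomputable def totalArea : ℕ := ∑ᶠ f, X.area f

/-- The Euler characteristic of the 1-skeleton of a finite complex; every edge has two
orientations. -/
noncomputable def skeletonEuler : ℝ := (Nat.card X.V : ℝ) - (Nat.card X.E : ℝ) / 2

/-- The total curvature. -/
noncomputable def totalCurvature : ℝ := (X.totalArea : ℝ) + X.skeletonEuler

/-- The average curvature. -/
noncomputable def averageCurvature : ℝ := X.totalCurvature / (X.totalArea : ℝ)

/-- The average curvatures of the finite irreducible complexes with an essential map to `X`. -/
def irreducibleCurvatures : Set EReal :=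
  {k | ∃ Y : BranchedComplex.{u}, Y.IsFinite ∧ Y.IsIrreducible ∧
    (∃ φ : Hom Y X, φ.IsEssential) ∧ k = (Y.averageCurvature : EReal)}

/-- The average curvatures of the closed surfaces with an essential map to `X`. -/
def surfaceCurvatures : Set EReal :=
  {k | ∃ Y : BranchedComplex.{u}, Y.IsSurface ∧
    (∃ φ : Hom Y X, φ.IsEssential) ∧ k = (Y.averageCurvature : EReal)}

/-- The maximal irreducible curvature. -/
noncomputable def rhoPlus : EReal := sSup X.irreducibleCurvatures

/-- The minimal irreducible curvature. -/
noncomputable def rhoMinus : EReal := sInf X.irreducibleCurvatures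

/-- The maximal surface curvature. -/
noncomputable def sigmaPlus : EReal := sSup X.surfaceCurvatures

/-- The minimal surface curvature. -/
noncomputable def sigmaMinus : EReal := sInf X.surfaceCurvatures

end BranchedComplex

/-!
The sets of average curvatures that define the four invariants are the same for `X'` and for `X`.

An essential map `Y → X'` stays essential after composition with the covering `φ : X' → X`, since
`φ` is a branched immersion and the folding of `Y → X'` also folds the composite. This is
`Hom.IsEssential.comp`.

Conversely, let `Y → Z → X` be the folding of an essential map. The degree of `φ` may vary from one
component of `X` to another, so `X'` is first replaced by a union `X''` of copies of its components
that covers `X` with constant degree `N` (`exists_isBranchedCovering_of_constant_degree`). The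
fibre products `Y'` and `Z'` of `Y` and `Z` with `X''` over `X` are branched coverings of `Y` and
`Z` of degree `N`, and `Y' → Z' → X''` is again an essential folding (`fibreSnd_isEssential`).
Its composite with `X'' → X'` is essential. Area and the Euler characteristic of the 1-skeleton are
multiplied by `N`, so `Y'` has the same average curvature as `Y`
(`Hom.IsBranchedCovering.averageCurvature_eq`). If `Y` is a surface, so is `Y'`, because links are
preserved by branched coverings. If `Y` is irreducible, pulling back a visibly irreducible model
shows that `Y'` is (`Hom.IsBranchedCovering.isIrreducible`).

Two facts make the fibre products work. Homotopies of edge paths lift along graph coverings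
(`SerreGraph.Hom.IsStarInjective.homotopic_lift`); as homotopies are allowed to pass through lists
of edges that are not paths, this is proved by comparing reduced forms. The faces of a fibre product
are the orbits of pairs of sides, and branched morphisms can be handled through their effect on
sides alone (`Hom.ofSides`, `Hom.ext_of_sides`), because the area of a face divided by its number
of sides is preserved by every branched morphism (`Hom.density_onD`).
-/

/-! ### Edge paths and their reductions -/

namespace SerreGraph

variable {G H : SerreGraph.{u}}

theorem tgt_inv (G : SerreGraph.{u}) (e : G.E) : G.tgt (G.inv e) = G.src e := by
  simp [tgt, G.inv_inv]

theorem isWalk_nil_iff {v w : G.V} : G.IsWalk v [] w ↔ v = w :=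
  ⟨fun h => by cases h; rfl, fun h => h ▸ IsWalk.nil v⟩

theorem isWalk_cons_iff {v w : G.V} {e : G.E} {p : List G.E} :
    G.IsWalk v (e :: p) w ↔ G.src e = v ∧ G.IsWalk (G.tgt e) p w := by
  constructor
  · rintro (_ | ⟨_, h⟩)
    exact ⟨rfl, h⟩
  · rintro ⟨rfl, h⟩
    exact IsWalk.cons e h

theorem IsWalk.append {v w x : G.V} {p q : List G.E} (hp : G.IsWalk v p w)
    (hq : G.IsWalk w q x) : G.IsWalk v (p ++ q) x := by
  induction hp with
  | nil v => exact hq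
  | cons e _ ih => exact IsWalk.cons e (ih hq)

/-- The edge path `p` traversed backwards. -/
def reversePath (G : SerreGraph.{u}) (p : List G.E) : List G.E := (p.map G.inv).reverse

theorem IsWalk.reversePath {v w : G.V} {p : List G.E} (hp : G.IsWalk v p w) :
    G.IsWalk w (G.reversePath p) v := by
  induction hp with
  | nil v => exact IsWalk.nil v
  | cons e h ih =>
    simp only [SerreGraph.reversePath, List.map_cons, List.reverse_cons] at ih ⊢
    refine ih.append (isWalk_cons_iff.2 ⟨rfl, isWalk_nil_iff.2 ?_⟩)
    exact G.tgt_inv e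

theorem IsWalk.target_unique {v w x : G.V} {p : List G.E} (hp : G.IsWalk v p w)
    (hq : G.IsWalk v p x) : w = x := by
  induction hp with
  | nil v => exact isWalk_nil_iff.1 hq
  | cons e h ih => exact ih (isWalk_cons_iff.1 hq).2

theorem IsWalk.map (g : Hom G H) {v w : G.V} {p : List G.E} (hp : G.IsWalk v p w) :
    H.IsWalk (g.onV v) (p.map g.onE) (g.onV w) := by
  induction hp with
  | nil v => exact IsWalk.nil _
  | cons e h ih =>
    refine isWalk_cons_iff.2 ⟨(g.map_src e).symm, ?_⟩
    rwa [show g.onV (G.tgt e) = H.tgt (g.onE e) by simp [tgt, g.map_src, g.map_inv]] at ih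

theorem Homotopic.refl (p : List G.E) : G.Homotopic p p := Relation.EqvGen.refl p

theorem Homotopic.symm {p q : List G.E} (h : G.Homotopic p q) : G.Homotopic q p :=
  Relation.EqvGen.symm _ _ h

theorem Homotopic.trans {p q r : List G.E} (h : G.Homotopic p q) (h' : G.Homotopic q r) :
    G.Homotopic p r :=
  Relation.EqvGen.trans _ _ _ h h'

theorem Homotopic.map (g : Hom G H) {p q : List G.E} (h : G.Homotopic p q) :
    H.Homotopic (p.map g.onE) (q.map g.onE) := by
  induction h with
  | rel _ _ h =>
    obtain ⟨p, q, e⟩ := h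
    simp only [List.map_append, List.map_cons, g.map_inv]
    exact Relation.EqvGen.rel _ _ (Backtrack.del _ _ _)
  | refl _ => exact Homotopic.refl _
  | symm _ _ _ ih => exact ih.symm
  | trans _ _ _ _ _ ih₁ ih₂ => exact ih₁.trans ih₂

theorem Homotopic.append_left (r : List G.E) {p q : List G.E} (h : G.Homotopic p q) :
    G.Homotopic (r ++ p) (r ++ q) := by
  induction h with
  | rel _ _ h =>
    obtain ⟨p, q, e⟩ := h
    simp only [← List.append_assoc]
    exact Relation.EqvGen.rel _ _ (Backtrack.del _ _ _)
  | refl _ => exact Homotopic.refl _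
  | symm _ _ _ ih => exact ih.symm
  | trans _ _ _ _ _ ih₁ ih₂ => exact ih₁.trans ih₂

theorem Homotopic.append_right (r : List G.E) {p q : List G.E} (h : G.Homotopic p q) :
    G.Homotopic (p ++ r) (q ++ r) := by
  induction h with
  | rel _ _ h =>
    obtain ⟨p, q, e⟩ := h
    simp only [List.append_assoc, List.cons_append]
    exact Relation.EqvGen.rel _ _ (Backtrack.del _ _ _)
  | refl _ => exact Homotopic.refl _
  | symm _ _ _ ih => exact ih.symm
  | trans _ _ _ _ _ ih₁ ih₂ => exact ih₁.trans ih₂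

theorem homotopic_reversePath_append (p : List G.E) :
    G.Homotopic (G.reversePath p ++ p) [] := by
  induction p with
  | nil => exact Homotopic.refl _
  | cons e p ih =>
    refine Homotopic.trans (Relation.EqvGen.rel _ _ ?_) ih
    have := Backtrack.del (G := G) (G.reversePath p) p (G.inv e)
    rw [G.inv_inv] at this
    simpa [reversePath] using this

open Classical in
/-- Prepend an edge to a path, cancelling it against the first edge if possible. -/
noncomputable def consReduced (G : SerreGraph.{u}) (e : G.E) (p : List G.E) : List G.E :=
  if p.head? = some (G.inv e) then p.tail else e :: p

/-- The path without backtracks that is homotopic to a given path. -/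
noncomputable def reduce (G : SerreGraph.{u}) (p : List G.E) : List G.E :=
  p.foldr G.consReduced []

/-- Edge paths without backtracks. -/
def IsReduced (G : SerreGraph.{u}) (p : List G.E) : Prop :=
  p.IsChain fun a b => b ≠ G.inv a

theorem IsReduced.consReduced (e : G.E) {p : List G.E} (hp : G.IsReduced p) :
    G.IsReduced (G.consReduced e p) := by
  unfold SerreGraph.consReduced
  split_ifs with h
  · exact List.IsChain.tail hp
  · cases p with
    | nil => exact List.isChain_singleton _
    | cons a p =>
      refine List.isChain_cons_cons.2 ⟨?_, hp⟩
      simpa using h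

theorem isReduced_reduce (p : List G.E) : G.IsReduced (G.reduce p) := by
  induction p with
  | nil => exact List.isChain_nil
  | cons e p ih => exact ih.consReduced e

theorem consReduced_inv (e : G.E) {p : List G.E} (hp : G.IsReduced p) :
    G.consReduced e (G.consReduced (G.inv e) p) = p := by
  cases p with
  | nil => simp [consReduced]
  | cons a p =>
    by_cases ha : a = e
    · subst ha
      have : ¬ p.head? = some (G.inv a) := by
        cases p with
        | nil => simp
        | cons b p => simpa using (List.isChain_cons_cons.1 hp).1
      simp [consReduced, G.inv_inv, this]
    · simp [consReduced, G.inv_inv, ha]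

theorem homotopic_consReduced (e : G.E) (p : List G.E) :
    G.Homotopic (e :: p) (G.consReduced e p) := by
  unfold consReduced
  split_ifs with h
  · cases p with
    | nil => simp at h
    | cons a p =>
      obtain rfl : a = G.inv e := by simpa using h
      exact Relation.EqvGen.rel _ _ (Backtrack.del [] p e)
  · exact Homotopic.refl _

theorem homotopic_reduce (p : List G.E) : G.Homotopic p (G.reduce p) := by
  induction p with
  | nil => exact Homotopic.refl _
  | cons e p ih => exact (ih.append_left [e]).trans (homotopic_consReduced e _)

/-- Reduced paths are normal forms for homotopy, which here passes through arbitrary lists of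
edges, not only through edge paths. -/
theorem Homotopic.reduce_eq {p q : List G.E} (h : G.Homotopic p q) :
    G.reduce p = G.reduce q := by
  induction h with
  | rel _ _ h =>
    obtain ⟨p, q, e⟩ := h
    simp only [reduce, List.foldr_append, List.foldr_cons]
    have hq := consReduced_inv e (isReduced_reduce q)
    unfold reduce at hq
    rw [hq]
  | refl _ => rfl
  | symm _ _ _ ih => exact ih.symm
  | trans _ _ _ _ _ ih₁ ih₂ => exact ih₁.trans ih₂

theorem IsWalk.consReduced {e : G.E} {p : List G.E} {w : G.V} (hp : G.IsWalk (G.tgt e) p w) :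
    G.IsWalk (G.src e) (G.consReduced e p) w := by
  unfold SerreGraph.consReduced
  split_ifs with h
  · cases p with
    | nil => simp at h
    | cons a p =>
      obtain rfl : a = G.inv e := by simpa using h
      simpa [G.tgt_inv] using (isWalk_cons_iff.1 hp).2
  · exact IsWalk.cons e hp

theorem IsWalk.reduce {v w : G.V} {p : List G.E} (hp : G.IsWalk v p w) :
    G.IsWalk v (G.reduce p) w := by
  induction hp with
  | nil v => exact IsWalk.nil v
  | cons e _ ih => exact ih.consReduced

/-! ### Lifting edge paths -/

namespace Hom

/-- Immersions of graphs: injective on the stars of vertices. -/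
def IsStarInjective (g : Hom G H) : Prop :=
  ∀ v, Set.InjOn g.onE {e | G.src e = v}

/-- Coverings of graphs onto a union of components: bijective on the stars of vertices. -/
def IsStarBijective (g : Hom G H) : Prop :=
  ∀ v, Set.BijOn g.onE {e | G.src e = v} {e | H.src e = g.onV v}

theorem IsStarBijective.isStarInjective {g : Hom G H} (hg : g.IsStarBijective) :
    g.IsStarInjective :=
  fun v => (hg v).injOn

theorem IsStarInjective.lift_unique {g : Hom G H} (hg : g.IsStarInjective) {v w x : G.V}
    {p q : List G.E} (hp : G.IsWalk v p w) (hq : G.IsWalk v q x)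
    (h : p.map g.onE = q.map g.onE) : p = q := by
  induction hp generalizing q with
  | nil v => simpa using h.symm
  | cons e hp ih =>
    cases q with
    | nil => simp at h
    | cons a q =>
      simp only [List.map_cons, List.cons.injEq] at h
      obtain ⟨ha, hq⟩ := isWalk_cons_iff.1 hq
      obtain rfl := hg _ rfl ha h.1
      rw [ih hq h.2]

theorem IsStarInjective.map_reduce {g : Hom G H} (hg : g.IsStarInjective) {v w : G.V}
    {p : List G.E} (hp : G.IsWalk v p w) :
    H.reduce (p.map g.onE) = (G.reduce p).map g.onE := by
  induction hp with
  | nil v => rfl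
  | @cons e p w hp ih =>
    change H.consReduced _ (H.reduce (p.map g.onE)) = (G.consReduced e (G.reduce p)).map g.onE
    rw [ih]
    have hr := hp.reduce
    generalize G.reduce p = r at hr
    cases r with
    | nil => simp [consReduced]
    | cons a r =>
      -- a cancellation downstairs is one upstairs, because `a` starts where `e` ends
      have : g.onE a = H.inv (g.onE e) ↔ a = G.inv e := by
        rw [← g.map_inv]
        exact ⟨fun h => hg _ (isWalk_cons_iff.1 hr).1 rfl h, fun h => by rw [h]⟩
      by_cases h : a = G.inv e
      · simp [consReduced, h, g.map_inv]
      · simp [consReduced, this, h]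

/-- Homotopies lift along immersions of graphs. -/
theorem IsStarInjective.homotopic_lift {g : Hom G H} (hg : g.IsStarInjective) {v w x : G.V}
    {p q : List G.E} (hp : G.IsWalk v p w) (hq : G.IsWalk v q x)
    (h : H.Homotopic (p.map g.onE) (q.map g.onE)) : G.Homotopic p q ∧ w = x := by
  have h' := h.reduce_eq
  rw [hg.map_reduce hp, hg.map_reduce hq] at h'
  have hpq := hg.lift_unique hp.reduce hq.reduce h'
  refine ⟨(homotopic_reduce p).trans (hpq ▸ (homotopic_reduce q).symm), ?_⟩
  exact hp.reduce.target_unique (hpq ▸ hq.reduce)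

theorem IsStarBijective.exists_lift {g : Hom G H} (hg : g.IsStarBijective) {v : G.V}
    {y : H.V} {q : List H.E} (hq : H.IsWalk (g.onV v) q y) :
    ∃ p w, G.IsWalk v p w ∧ p.map g.onE = q ∧ g.onV w = y := by
  induction q generalizing v with
  | nil => exact ⟨[], v, IsWalk.nil v, rfl, isWalk_nil_iff.1 hq⟩
  | cons a q ih =>
    obtain ⟨ha, hq'⟩ := isWalk_cons_iff.1 hq
    obtain ⟨e, rfl, rfl⟩ := (hg v).surjOn ha
    rw [show H.tgt (g.onE e) = g.onV (G.tgt e) by simp [tgt, g.map_src, g.map_inv]] at hq'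
    obtain ⟨p, w, hp, rfl, hw⟩ := ih hq'
    exact ⟨e :: p, w, IsWalk.cons e hp, rfl, hw⟩

end Hom

end SerreGraph

/-! ### Sides of faces -/

theorem Nat.card_eq_mul_of_card_fibre {α β : Type*} [Finite α] [Finite β] (f : α → β) (n : ℕ)
    (h : ∀ b, Nat.card {a // f a = b} = n) : Nat.card α = n * Nat.card β := by
  have := Fintype.ofFinite β
  rw [Nat.card_congr (Equiv.sigmaFiberEquiv f).symm, Nat.card_sigma]
  simp [h, mul_comm]

namespace BranchedComplex

variable {X Y Z : BranchedComplex.{u}}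

/-- Two sides are related if they are opposite orientations of one side or if they start at the
same point of the boundary circle. -/
def SideStep (X : BranchedComplex.{u}) (d d' : X.D) : Prop := d' = X.rev d ∨ d' = X.opp d

theorem face_eq_iff {d d' : X.D} :
    X.face d = X.face d' ↔ Relation.ReflTransGen X.SideStep d d' := by
  refine ⟨X.face_connected d d', fun h => ?_⟩
  induction h with
  | refl => rfl
  | tail _ h ih =>
    rcases h with rfl | rfl
    · rw [ih, X.face_rev]
    · rw [ih, X.face_opp]

theorem numSides_pos (f : X.F) : 0 < X.numSides f := by
  obtain ⟨d, hd⟩ := X.face_surjective f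
  have := X.face_finite f
  have : Nonempty {d // X.face d = f} := ⟨⟨d, hd⟩⟩
  exact Nat.card_pos

/-- The area of the face of `d` that is allotted to the side `d`.  Branched morphisms preserve
it. -/
noncomputable def density (X : BranchedComplex.{u}) (d : X.D) : ℚ :=
  X.area (X.face d) / X.numSides (X.face d)

/-- A map of sides is equivariant if it commutes with `rev` and `opp`. -/
structure IsSideMap (Y X : BranchedComplex.{u}) (k : Y.D → X.D) : Prop where
  map_rev : ∀ d, k (Y.rev d) = X.rev (k d)
  map_opp : ∀ d, k (Y.opp d) = X.opp (k d)

namespace IsSideMap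

variable {k : Y.D → X.D}

theorem map_sideStep (hk : IsSideMap Y X k) {d d' : Y.D} (h : Y.SideStep d d') :
    X.SideStep (k d) (k d') := by
  rcases h with rfl | rfl
  · exact Or.inl (hk.map_rev d)
  · exact Or.inr (hk.map_opp d)

theorem face_eq (hk : IsSideMap Y X k) {d d' : Y.D} (h : Y.face d = Y.face d') :
    X.face (k d) = X.face (k d') := by
  rw [face_eq_iff] at h ⊢
  exact Relation.ReflTransGen.lift k (fun _ _ => hk.map_sideStep) _ _ h

theorem exists_lift (hk : IsSideMap Y X k) {d : Y.D} {b : X.D} (h : X.face (k d) = X.face b) :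
    ∃ d', Y.face d = Y.face d' ∧ k d' = b := by
  rw [face_eq_iff] at h
  induction h with
  | refl => exact ⟨d, rfl, rfl⟩
  | tail _ h ih =>
    obtain ⟨d', hd', rfl⟩ := ih
    rcases h with rfl | rfl
    · exact ⟨Y.rev d', by rw [Y.face_rev, hd'], hk.map_rev d'⟩
    · exact ⟨Y.opp d', by rw [Y.face_opp, hd'], hk.map_opp d'⟩

/-- The fibres of an equivariant map of sides over the sides of a face have the same
cardinality, because `rev` and `opp` act on them by bijections. -/
theorem card_fibre_eq (hk : IsSideMap Y X k) (f : Y.F) {b b' : X.D} (h : X.face b = X.face b') :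
    Nat.card {d // Y.face d = f ∧ k d = b'} = Nat.card {d // Y.face d = f ∧ k d = b} := by
  rw [face_eq_iff] at h
  induction h with
  | refl => rfl
  | @tail c c' _ h ih =>
    rw [← ih]
    rcases h with rfl | rfl
    · have hY : Function.Involutive Y.rev := Y.rev_rev
      refine Nat.card_congr (hY.toPerm.subtypeEquiv fun d => ?_)
      rw [hY.coe_toPerm, Y.face_rev, hk.map_rev]
      exact and_congr_right fun _ => ⟨fun h => by rw [h, X.rev_rev], fun h => by
        rw [← h, X.rev_rev]⟩
    · have hY : Function.Involutive Y.opp := Y.opp_opp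
      refine Nat.card_congr (hY.toPerm.subtypeEquiv fun d => ?_)
      rw [hY.coe_toPerm, Y.face_opp, hk.map_opp]
      exact and_congr_right fun _ => ⟨fun h => by rw [h, X.opp_opp], fun h => by
        rw [← h, X.opp_opp]⟩

/-- The boundary circle of a face covers that of its image evenly. -/
theorem numSides_dvd (hk : IsSideMap Y X k) (d : Y.D) :
    X.numSides (X.face (k d)) ∣ Y.numSides (Y.face d) := by
  have := Y.face_finite (Y.face d)
  have := X.face_finite (X.face (k d))
  refine Dvd.intro_left _ (Nat.card_eq_mul_of_card_fibre
    (fun a : {a // Y.face a = Y.face d} =>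
      (⟨k a, hk.face_eq a.2⟩ : {b // X.face b = X.face (k d)}))
    (Nat.card {a // Y.face a = Y.face d ∧ k a = k d}) fun b => ?_).symm
  refine Eq.trans ?_ (hk.card_fibre_eq (Y.face d) b.2.symm)
  refine Nat.card_congr ((Equiv.subtypeEquivRight fun a => ?_).trans
    (Equiv.subtypeSubtypeEquivSubtypeInter (fun a => Y.face a = Y.face d) fun a => k a = b))
  exact Subtype.ext_iff

end IsSideMap

namespace Hom

theorem isSideMap (φ : Hom Y X) : IsSideMap Y X φ.onD := ⟨φ.map_rev, φ.map_opp⟩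

theorem density_onD (φ : Hom Y X) (d : Y.D) : X.density (φ.onD d) = Y.density d := by
  unfold density
  rw [← φ.map_face, φ.numSides_eq, φ.area_eq]
  have h : φ.mult (Y.face d) ≠ 0 := fun h => by
    have := φ.area_eq (Y.face d)
    rw [h, zero_mul] at this
    exact (Y.area_pos _).ne' this
  push_cast
  rw [mul_div_mul_left _ _ (by exact_mod_cast h)]

/-- A branched morphism is determined by its effect on vertices, edges and sides. -/
theorem ext_of_sides {φ ψ : Hom Y X} (hV : φ.onV = ψ.onV) (hE : φ.onE = ψ.onE)
    (hD : φ.onD = ψ.onD) : φ = ψ := by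
  have hF : φ.onF = ψ.onF := by
    funext f
    obtain ⟨d, rfl⟩ := Y.face_surjective f
    rw [φ.map_face, ψ.map_face, hD]
  refine Hom.ext hV hE hF hD (funext fun f => ?_)
  have h := φ.numSides_eq f
  rw [ψ.numSides_eq, hF] at h
  exact (Nat.eq_of_mul_eq_mul_right (numSides_pos _) h).symm

/-- The branched morphism given by a graph morphism and an equivariant map of sides over it that
preserves the density of area. -/
noncomputable def ofSides (g : SerreGraph.Hom Y.toSerreGraph X.toSerreGraph) (k : Y.D → X.D)
    (hk : IsSideMap Y X k) (hb : ∀ d, g.onE (Y.bdry d) = X.bdry (k d))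
    (ha : ∀ d, X.density (k d) = Y.density d) : Hom Y X where
  toHom := g
  onF f := X.face (k (Y.face_surjective f).choose)
  onD := k
  mult f := Y.numSides f / X.numSides (X.face (k (Y.face_surjective f).choose))
  map_face d := hk.face_eq (Y.face_surjective (Y.face d)).choose_spec
  map_rev := hk.map_rev
  map_opp := hk.map_opp
  map_bdry := hb
  numSides_eq f := by
    have h := hk.numSides_dvd (Y.face_surjective f).choose
    rw [(Y.face_surjective f).choose_spec] at h
    exact (Nat.div_mul_cancel h).symm
  area_eq f := by
    have h := hk.numSides_dvd (Y.face_surjective f).choose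
    have h' := ha (Y.face_surjective f).choose
    simp only [density] at h'
    rw [(Y.face_surjective f).choose_spec] at h h'
    generalize X.face (k (Y.face_surjective f).choose) = f' at h h'
    obtain ⟨m, hm⟩ := h
    have h₁ : (X.numSides f' : ℚ) ≠ 0 := by exact_mod_cast (numSides_pos f').ne'
    have h₂ : (m : ℚ) ≠ 0 := by
      rintro h
      have := numSides_pos f
      rw [hm, Nat.cast_eq_zero.1 h] at this
      exact this.ne' rfl
    rw [hm, Nat.mul_div_cancel_left _ (numSides_pos f')]
    rw [hm] at h'
    push_cast at h'
    field_simp at h'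
    exact_mod_cast (show (Y.area f : ℚ) = m * X.area f' by linarith)

theorem bijective_onD {φ : Hom Y X} (hF : Function.Bijective φ.onF)
    (hm : ∀ f, φ.mult f = 1) : Function.Bijective φ.onD := by
  constructor
  · intro d d' h
    have hf : Y.face d = Y.face d' := hF.1 (by rw [φ.map_face, φ.map_face, h])
    -- on the sides of one face, `φ.onD` is a surjection between sets of the same cardinality
    let k : {a // Y.face a = Y.face d'} → {b // X.face b = φ.onF (Y.face d')} :=
      fun a => ⟨φ.onD a, by rw [← φ.map_face, a.2]⟩
    have hk : Function.Surjective k := by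
      rintro ⟨b, hb⟩
      rw [φ.map_face] at hb
      obtain ⟨a, ha, rfl⟩ := φ.isSideMap.exists_lift hb.symm
      exact ⟨⟨a, ha.symm⟩, rfl⟩
    have := Y.face_finite (Y.face d')
    have hcard := φ.numSides_eq (Y.face d')
    rw [hm, one_mul] at hcard
    have hkb := hk.bijective_of_nat_card_le hcard.le
    have := hkb.1 (a₁ := ⟨d, hf⟩) (a₂ := ⟨d', rfl⟩) (Subtype.ext h)
    exact congrArg Subtype.val this
  · intro b
    obtain ⟨f, hf⟩ := hF.2 (X.face b)
    obtain ⟨d, rfl⟩ := Y.face_surjective f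
    rw [φ.map_face] at hf
    obtain ⟨a, -, ha⟩ := φ.isSideMap.exists_lift hf
    exact ⟨a, ha⟩

theorem surjective_onF {φ : Hom Y X} (hD : Function.Surjective φ.onD) :
    Function.Surjective φ.onF := by
  intro f
  obtain ⟨b, rfl⟩ := X.face_surjective f
  obtain ⟨d, rfl⟩ := hD b
  exact ⟨Y.face d, φ.map_face d⟩

theorem face_eq_of_bijective_onD {φ : Hom Y X} (hD : Function.Bijective φ.onD) {d d' : Y.D}
    (h : X.face (φ.onD d) = X.face (φ.onD d')) : Y.face d = Y.face d' := by
  obtain ⟨a, ha, h'⟩ := φ.isSideMap.exists_lift h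
  rw [ha, hD.1 h']

theorem bijective_onF {φ : Hom Y X} (hD : Function.Bijective φ.onD) :
    Function.Bijective φ.onF := by
  refine ⟨fun f f' h => ?_, surjective_onF hD.2⟩
  obtain ⟨d, rfl⟩ := Y.face_surjective f
  obtain ⟨d', rfl⟩ := Y.face_surjective f'
  rw [φ.map_face, φ.map_face] at h
  exact face_eq_of_bijective_onD hD h

theorem mult_eq_one {φ : Hom Y X} (hD : Function.Bijective φ.onD) (f : Y.F) :
    φ.mult f = 1 := by
  have h : Y.numSides f = X.numSides (φ.onF f) := by
    refine Nat.card_congr ((Equiv.ofBijective φ.onD hD).subtypeEquiv fun d => ?_)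
    rw [Equiv.ofBijective_apply, ← φ.map_face]
    exact (bijective_onF hD).1.eq_iff.symm
  have h' := φ.numSides_eq f
  rw [h] at h'
  exact Nat.eq_of_mul_eq_mul_right (numSides_pos _) (by rw [one_mul]; exact h'.symm)

end Hom

/-! ### Complexes over a given complex -/

/-- A graph with sides that lies over a branched 2-complex `X`.  The faces of the complex that it
spans are the orbits of sides, which are required to be finite. -/
structure SideData (X : BranchedComplex.{u}) where
  G : SerreGraph.{u}
  toGraphHom : SerreGraph.Hom G X.toSerreGraph
  D : Type u
  rev : D → D
  opp : D → D
  bdry : D → G.E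
  onD : D → X.D
  rev_rev : ∀ d, rev (rev d) = d
  opp_opp : ∀ d, opp (opp d) = d
  bdry_rev : ∀ d, bdry (rev d) = G.inv (bdry d)
  src_bdry_opp : ∀ d, G.src (bdry (opp d)) = G.src (bdry d)
  map_rev : ∀ d, onD (rev d) = X.rev (onD d)
  map_opp : ∀ d, onD (opp d) = X.opp (onD d)
  map_bdry : ∀ d, toGraphHom.onE (bdry d) = X.bdry (onD d)
  orbit_finite : ∀ d,
    {d' | Relation.ReflTransGen (fun a b => b = rev a ∨ b = opp a) d d'}.Finite
  nonempty_D : Nonempty D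

namespace SideData

variable (S : SideData X)

/-- Two sides are equivalent if they are sides of the same face. -/
def setoid : Setoid S.D where
  r := Relation.ReflTransGen (fun a b => b = S.rev a ∨ b = S.opp a)
  iseqv := by
    refine ⟨fun _ => .refl, fun h => ?_, fun h h' => h.trans h'⟩
    have : Std.Symm fun a b => b = S.rev a ∨ b = S.opp a := by
      constructor
      rintro a b (rfl | rfl)
      · exact Or.inl (S.rev_rev a).symm
      · exact Or.inr (S.opp_opp a).symm
    exact Relation.ReflTransGen.stdSymm.symm _ _ h

theorem onD_face {d d' : S.D} (h : S.setoid d d') :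
    X.face (S.onD d) = X.face (S.onD d') := by
  refine face_eq_iff.2 (Relation.ReflTransGen.lift S.onD ?_ _ _ h)
  rintro a b (rfl | rfl)
  · exact Or.inl (S.map_rev a)
  · exact Or.inr (S.map_opp a)

/-- The complex without its areas: all areas are set to `1`. -/
def unitComplex : BranchedComplex.{u} where
  toSerreGraph := S.G
  F := Quotient S.setoid
  D := S.D
  face := Quotient.mk S.setoid
  rev := S.rev
  opp := S.opp
  bdry := S.bdry
  rev_rev := S.rev_rev
  opp_opp := S.opp_opp
  bdry_rev := S.bdry_rev
  src_bdry_opp := S.src_bdry_opp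
  bdry_opp_ne d h := X.bdry_opp_ne (S.onD d) (by rw [← S.map_opp, ← S.map_bdry, h, S.map_bdry])
  face_surjective := Quotient.mk_surjective
  face_rev d := Quotient.sound (S.setoid.symm (Relation.ReflTransGen.single (Or.inl rfl)))
  face_opp d := Quotient.sound (S.setoid.symm (Relation.ReflTransGen.single (Or.inr rfl)))
  face_connected _ _ h := Quotient.exact h
  face_finite f := by
    obtain ⟨d, rfl⟩ := Quotient.mk_surjective f
    refine ((S.orbit_finite d).subset fun d' h => ?_).to_subtype
    exact S.setoid.symm (Quotient.exact h)
  area _ := 1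
  area_pos _ := one_pos
  nonempty_F := S.nonempty_D.map (Quotient.mk S.setoid)

theorem isSideMap : IsSideMap S.unitComplex X S.onD := ⟨S.map_rev, S.map_opp⟩

/-- The image in `X` of a face. -/
def onF : Quotient S.setoid → X.F :=
  Quotient.lift (fun d => X.face (S.onD d)) fun _ _ => S.onD_face

/-- The branched 2-complex over `X` that is spanned by `S`.  Areas are such that the projection
to `X` is a branched morphism. -/
noncomputable def complex : BranchedComplex.{u} where
  toSerreGraph := S.G
  F := Quotient S.setoid
  D := S.D
  face := Quotient.mk S.setoid
  rev := S.rev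
  opp := S.opp
  bdry := S.bdry
  rev_rev := S.rev_rev
  opp_opp := S.opp_opp
  bdry_rev := S.bdry_rev
  src_bdry_opp := S.src_bdry_opp
  bdry_opp_ne := S.unitComplex.bdry_opp_ne
  face_surjective := S.unitComplex.face_surjective
  face_rev := S.unitComplex.face_rev
  face_opp := S.unitComplex.face_opp
  face_connected := S.unitComplex.face_connected
  face_finite := S.unitComplex.face_finite
  area f := S.unitComplex.numSides f / X.numSides (S.onF f) * X.area (S.onF f)
  area_pos f := by
    obtain ⟨d, rfl⟩ := Quotient.mk_surjective f
    exact Nat.mul_pos (Nat.div_pos (Nat.le_of_dvd (numSides_pos (X := S.unitComplex) _)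
      (S.isSideMap.numSides_dvd d)) (numSides_pos _)) (X.area_pos _)
  nonempty_F := S.unitComplex.nonempty_F

/-- The projection to `X` of the complex spanned by `S`. -/
noncomputable def proj : Hom S.complex X where
  toHom := S.toGraphHom
  onF := S.onF
  onD := S.onD
  mult f := S.unitComplex.numSides f / X.numSides (S.onF f)
  map_face _ := rfl
  map_rev := S.map_rev
  map_opp := S.map_opp
  map_bdry := S.map_bdry
  numSides_eq f := by
    obtain ⟨d, rfl⟩ := Quotient.mk_surjective f
    exact (Nat.div_mul_cancel (S.isSideMap.numSides_dvd d)).symm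
  area_eq _ := rfl

end SideData

end BranchedComplex

/-! ### Fibre products -/

namespace BranchedComplex

variable {X X' Y Z : BranchedComplex.{u}}

/-- The fibre product of 1-skeleta. -/
def fibreGraph (φ : Hom Y X) (c : Hom X' X) : SerreGraph.{u} where
  V := {p : Y.V × X'.V // φ.onV p.1 = c.onV p.2}
  E := {p : Y.E × X'.E // φ.onE p.1 = c.onE p.2}
  src e := ⟨(Y.src e.1.1, X'.src e.1.2), by rw [φ.map_src, c.map_src, e.2]⟩
  inv e := ⟨(Y.inv e.1.1, X'.inv e.1.2), by rw [φ.map_inv, c.map_inv, e.2]⟩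
  inv_inv e := Subtype.ext (Prod.ext (Y.inv_inv _) (X'.inv_inv _))
  inv_ne e h := Y.inv_ne e.1.1 (congrArg (fun e => e.1.1) h)

/-- The data over `Y` of the fibre product of `Y` and `X'` over `X`.  Its sides are pairs of
sides; its faces are the components of the fibre products of boundary circles. -/
def fibreData (φ : Hom Y X) (c : Hom X' X) (hc : Function.Surjective c.onD) : SideData Y where
  G := fibreGraph φ c
  toGraphHom :=
    { onV := fun v => v.1.1
      onE := fun e => e.1.1
      map_src := fun _ => rfl
      map_inv := fun _ => rfl }
  D := {p : Y.D × X'.D // φ.onD p.1 = c.onD p.2}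
  rev d := ⟨(Y.rev d.1.1, X'.rev d.1.2), by rw [φ.map_rev, c.map_rev, d.2]⟩
  opp d := ⟨(Y.opp d.1.1, X'.opp d.1.2), by rw [φ.map_opp, c.map_opp, d.2]⟩
  bdry d := ⟨(Y.bdry d.1.1, X'.bdry d.1.2), by rw [φ.map_bdry, c.map_bdry, d.2]⟩
  onD d := d.1.1
  rev_rev d := Subtype.ext (Prod.ext (Y.rev_rev _) (X'.rev_rev _))
  opp_opp d := Subtype.ext (Prod.ext (Y.opp_opp _) (X'.opp_opp _))
  bdry_rev d := Subtype.ext (Prod.ext (Y.bdry_rev _) (X'.bdry_rev _))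
  src_bdry_opp d := Subtype.ext (Prod.ext (Y.src_bdry_opp _) (X'.src_bdry_opp _))
  map_rev _ := rfl
  map_opp _ := rfl
  map_bdry _ := rfl
  orbit_finite d := by
    have h₁ : {a | Y.face a = Y.face d.1.1}.Finite := Set.finite_coe_iff.1 (Y.face_finite _)
    have h₂ : {a | X'.face a = X'.face d.1.2}.Finite := Set.finite_coe_iff.1 (X'.face_finite _)
    refine ((h₁.prod h₂).preimage Subtype.val_injective.injOn).subset fun d' h => ?_
    induction h with
    | refl => exact ⟨rfl, rfl⟩
    | tail _ h ih =>
      rcases h with rfl | rfl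
      · exact ⟨(Y.face_rev _).trans ih.1, (X'.face_rev _).trans ih.2⟩
      · exact ⟨(Y.face_opp _).trans ih.1, (X'.face_opp _).trans ih.2⟩
  nonempty_D := by
    obtain ⟨f⟩ := Y.nonempty_F
    obtain ⟨d, -⟩ := Y.face_surjective f
    obtain ⟨d', hd'⟩ := hc (φ.onD d)
    exact ⟨⟨(d, d'), hd'.symm⟩⟩

/-- The fibre product of `Y` and `X'` over `X`. -/
noncomputable def fibreProduct (φ : Hom Y X) (c : Hom X' X) (hc : Function.Surjective c.onD) :
    BranchedComplex.{u} :=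
  (fibreData φ c hc).complex

/-- The projection of the fibre product to the first factor. -/
noncomputable def fibreFst (φ : Hom Y X) (c : Hom X' X) (hc : Function.Surjective c.onD) :
    Hom (fibreProduct φ c hc) Y :=
  (fibreData φ c hc).proj

/-- The projection of the fibre product to the second factor. -/
noncomputable def fibreSnd (φ : Hom Y X) (c : Hom X' X) (hc : Function.Surjective c.onD) :
    Hom (fibreProduct φ c hc) X' :=
  Hom.ofSides
    { onV := fun v => v.1.2
      onE := fun e => e.1.2
      map_src := fun _ => rfl
      map_inv := fun _ => rfl }
    (fun d => d.1.2) ⟨fun _ => rfl, fun _ => rfl⟩ (fun _ => rfl) fun d => by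
      rw [← (fibreFst φ c hc).density_onD d, ← φ.density_onD, ← c.density_onD]
      exact congrArg X.density d.2.symm

/-- The map of fibre products induced by a map of the first factors over `X`. -/
noncomputable def fibreMap (φ₀ : Hom Y Z) (ψ : Hom Z X) (c : Hom X' X)
    (hc : Function.Surjective c.onD) :
    Hom (fibreProduct (ψ.comp φ₀) c hc) (fibreProduct ψ c hc) :=
  Hom.ofSides
    { onV := fun v => ⟨(φ₀.onV v.1.1, v.1.2), v.2⟩
      onE := fun e => ⟨(φ₀.onE e.1.1, e.1.2), e.2⟩
      map_src := fun e => Subtype.ext (Prod.ext (φ₀.map_src e.1.1) rfl)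
      map_inv := fun e => Subtype.ext (Prod.ext (φ₀.map_inv e.1.1) rfl) }
    (fun d => ⟨(φ₀.onD d.1.1, d.1.2), d.2⟩)
    ⟨fun d => Subtype.ext (Prod.ext (φ₀.map_rev d.1.1) rfl),
      fun d => Subtype.ext (Prod.ext (φ₀.map_opp d.1.1) rfl)⟩
    (fun d => Subtype.ext (Prod.ext (φ₀.map_bdry d.1.1) rfl)) fun d => by
      refine ((fibreSnd ψ c hc).density_onD _).symm.trans ?_
      exact (fibreSnd (ψ.comp φ₀) c hc).density_onD d

theorem fibreSnd_comp_fibreMap (φ₀ : Hom Y Z) (ψ : Hom Z X) (c : Hom X' X)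
    (hc : Function.Surjective c.onD) :
    (fibreSnd ψ c hc).comp (fibreMap φ₀ ψ c hc) = fibreSnd (ψ.comp φ₀) c hc :=
  Hom.ext_of_sides rfl rfl rfl

theorem finite_sides (hX : X.IsFinite) : Finite X.D := by
  have := hX.finite_F
  have := X.face_finite
  exact Finite.of_equiv _ (Equiv.sigmaFiberEquiv X.face)

theorem fibreProduct_isFinite {φ : Hom Y X} {c : Hom X' X} {hc : Function.Surjective c.onD}
    (hY : Y.IsFinite) (hX' : X'.IsFinite) : (fibreProduct φ c hc).IsFinite := by
  have := hY.finite_V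
  have := hY.finite_E
  have := finite_sides hY
  have := hX'.finite_V
  have := hX'.finite_E
  have := finite_sides hX'
  have : Finite (fibreProduct φ c hc).D :=
    inferInstanceAs (Finite {p : Y.D × X'.D // φ.onD p.1 = c.onD p.2})
  exact
    { finite_V := inferInstanceAs (Finite {p : Y.V × X'.V // φ.onV p.1 = c.onV p.2})
      finite_E := inferInstanceAs (Finite {p : Y.E × X'.E // φ.onE p.1 = c.onE p.2})
      finite_F := Finite.of_surjective _ (fibreProduct φ c hc).face_surjective }

namespace Hom

theorem IsBranchedCovering.comp {ψ : Hom Z X} {φ : Hom Y Z} (hψ : ψ.IsBranchedCovering)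
    (hφ : φ.IsBranchedCovering) : (ψ.comp φ).IsBranchedCovering :=
  ⟨fun v => (hψ.bijective_edges _).comp (hφ.bijective_edges v),
    fun v => (hψ.bijective_corners _).comp (hφ.bijective_corners v)⟩

theorem IsBranchedImmersion.comp {ψ : Hom Z X} {φ : Hom Y Z} (hψ : ψ.IsBranchedImmersion)
    (hφ : φ.IsBranchedImmersion) : (ψ.comp φ).IsBranchedImmersion := by
  refine ⟨fun v => ?_, fun v => ?_⟩
  · refine (hψ.injective_edges (φ.onV v)).comp (hφ.injective_edges v) fun e he => ?_
    exact (φ.map_src e).symm.trans (congrArg φ.onV he)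
  · refine (hψ.injective_corners (φ.onV v)).comp (hφ.injective_corners v) fun d hd => ?_
    change Z.src (Z.bdry (φ.onD d)) = φ.onV v
    rw [← φ.map_bdry, ← φ.map_src, hd]

theorem IsBranchedCovering.isBranchedImmersion {φ : Hom Y X} (hφ : φ.IsBranchedCovering) :
    φ.IsBranchedImmersion :=
  ⟨fun v => (hφ.bijective_edges v).injOn, fun v => (hφ.bijective_corners v).injOn⟩

theorem IsBranchedCovering.surjective_onD {φ : Hom Y X} (hφ : φ.IsBranchedCovering)
    (hV : Function.Surjective φ.onV) : Function.Surjective φ.onD := by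
  intro d
  obtain ⟨v, hv⟩ := hV (X.src (X.bdry d))
  obtain ⟨d', -, hd'⟩ := (hφ.bijective_corners v).surjOn hv.symm
  exact ⟨d', hd'⟩

/-- Essential maps remain essential after composition with a branched immersion. -/
theorem IsEssential.comp {ψ : Hom Z X} {φ : Hom Y Z} (hψ : ψ.IsBranchedImmersion)
    (hφ : φ.IsEssential) : (ψ.comp φ).IsEssential := by
  obtain ⟨W, φ₀, χ, hf, hp⟩ := hφ
  obtain rfl := hf.factors
  exact ⟨W, φ₀, ψ.comp χ, { hf with
    factors := ext_of_sides rfl rfl rfl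
    immersion := hψ.comp hf.immersion }, hp⟩

end Hom

variable {c : Hom X' X} {hc : Function.Surjective c.onD}

theorem fibreFst_isBranchedCovering (φ : Hom Y X) (h : c.IsBranchedCovering) :
    (fibreFst φ c hc).IsBranchedCovering := by
  constructor
  · rintro ⟨⟨y, x⟩, hyx⟩
    refine ⟨?_, ?_, ?_⟩
    · intro e he
      exact congrArg (fun v => v.1.1) he
    · rintro ⟨⟨e, a⟩, hea⟩ he ⟨⟨e', a'⟩, hea'⟩ he' (rfl : e = e')
      obtain rfl : a = a' := (h.bijective_edges x).injOn (congrArg (fibreSnd φ c hc).onV he)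
        (congrArg (fibreSnd φ c hc).onV he') (hea.symm.trans hea')
      rfl
    · rintro e (rfl : Y.src e = y)
      obtain ⟨a, rfl, haE⟩ := (h.bijective_edges x).surjOn
        (show φ.onE e ∈ {e | X.src e = c.onV x} from (φ.map_src e).symm.trans hyx)
      exact ⟨⟨(e, a), haE.symm⟩, rfl, rfl⟩
  · rintro ⟨⟨y, x⟩, hyx⟩
    refine ⟨?_, ?_, ?_⟩
    · intro e he
      exact congrArg (fun v => v.1.1) he
    · rintro ⟨⟨e, a⟩, hea⟩ he ⟨⟨e', a'⟩, hea'⟩ he' (rfl : e = e')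
      obtain rfl : a = a' := (h.bijective_corners x).injOn (congrArg (fibreSnd φ c hc).onV he)
        (congrArg (fibreSnd φ c hc).onV he') (hea.symm.trans hea')
      rfl
    · rintro d (rfl : Y.src (Y.bdry d) = y)
      obtain ⟨a, rfl, haD⟩ := (h.bijective_corners x).surjOn
        (show φ.onD d ∈ {d | X.src (X.bdry d) = c.onV x} by
          change X.src (X.bdry (φ.onD d)) = c.onV x
          rw [← φ.map_bdry, ← φ.map_src]
          exact hyx)
      exact ⟨⟨(d, a), haD.symm⟩, rfl, rfl⟩

theorem fibreSnd_isBranchedImmersion {φ : Hom Y X} (h : φ.IsBranchedImmersion) :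
    (fibreSnd φ c hc).IsBranchedImmersion := by
  constructor
  · rintro ⟨⟨y, x⟩, hyx⟩ ⟨⟨e, a⟩, hea⟩ he ⟨⟨e', a'⟩, hea'⟩ he' (rfl : a = a')
    obtain rfl : e = e' := h.injective_edges y (congrArg (fibreFst φ c hc).onV he)
      (congrArg (fibreFst φ c hc).onV he') (hea.trans hea'.symm)
    rfl
  · rintro ⟨⟨y, x⟩, hyx⟩ ⟨⟨e, a⟩, hea⟩ he ⟨⟨e', a'⟩, hea'⟩ he' (rfl : a = a')
    obtain rfl : e = e' := h.injective_corners y (congrArg (fibreFst φ c hc).onV he)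
      (congrArg (fibreFst φ c hc).onV he') (hea.trans hea'.symm)
    rfl

theorem fibreSnd_isIso {φ : Hom Y X} (h : φ.IsIso) : (fibreSnd φ c hc).IsIso := by
  have hD : Function.Bijective (fibreSnd φ c hc).onD := by
    constructor
    · rintro ⟨⟨d, a⟩, hd⟩ ⟨⟨d', a'⟩, hd'⟩ (rfl : a = a')
      obtain rfl : d = d' := h.bijective_onD.1 (hd.trans hd'.symm)
      rfl
    · intro a
      obtain ⟨d, hd⟩ := h.bijective_onD.2 (c.onD a)
      exact ⟨⟨(d, a), hd⟩, rfl⟩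
  refine ⟨⟨?_, fun a => ?_⟩, ⟨?_, fun a => ?_⟩, Hom.bijective_onF hD, hD⟩
  · rintro ⟨⟨d, a⟩, hd⟩ ⟨⟨d', a'⟩, hd'⟩ (rfl : a = a')
    obtain rfl : d = d' := h.bijective_onV.1 (hd.trans hd'.symm)
    rfl
  · obtain ⟨d, hd⟩ := h.bijective_onV.2 (c.onV a)
    exact ⟨⟨(d, a), hd⟩, rfl⟩
  · rintro ⟨⟨d, a⟩, hd⟩ ⟨⟨d', a'⟩, hd'⟩ (rfl : a = a')
    obtain rfl : d = d' := h.bijective_onE.1 (hd.trans hd'.symm)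
    rfl
  · obtain ⟨d, hd⟩ := h.bijective_onE.2 (c.onE a)
    exact ⟨⟨(d, a), hd⟩, rfl⟩

theorem fibreMap_bijective_onD {φ₀ : Hom Y Z} (ψ : Hom Z X) (h : Function.Bijective φ₀.onD) :
    Function.Bijective (fibreMap φ₀ ψ c hc).onD := by
  constructor
  · rintro ⟨⟨d, a⟩, hd⟩ ⟨⟨d', a'⟩, hd'⟩ hdd
    obtain rfl : d = d' := h.1 (congrArg (fun d => d.1.1) hdd)
    obtain rfl : a = a' := congrArg (fun d => d.1.2) hdd
    rfl
  · rintro ⟨⟨d, a⟩, hd⟩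
    obtain ⟨d, rfl⟩ := h.2 d
    exact ⟨⟨(d, a), hd⟩, rfl⟩

/-! ### Essential maps pull back along branched coverings -/

/-- The map of fibre products carries lifts of `p` to lifts of the image of `p`. -/
theorem map_fibreFst_fibreMap (φ₀ : Hom Y Z) (ψ : Hom Z X)
    (p : List (fibreProduct (ψ.comp φ₀) c hc).E) :
    (p.map (fibreMap φ₀ ψ c hc).onE).map (fibreFst ψ c hc).onE =
      (p.map (fibreFst (ψ.comp φ₀) c hc).onE).map φ₀.onE := by
  simp only [List.map_map]
  rfl

section Lifting

variable {φ₀ : Hom Y Z} {ψ : Hom Z X} (h : c.IsBranchedCovering)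

include h

theorem fibreFst_isStarBijective (φ : Hom Y X) :
    (fibreFst φ c hc).toHom.IsStarBijective :=
  (fibreFst_isBranchedCovering φ h).bijective_edges

/-- If the projection of a path in the fibre product over `Z` is homotopic to the image of a path
in `Y`, then the path itself is homotopic to the image of a lift of the latter. -/
theorem exists_lift_homotopic {u : (fibreProduct (ψ.comp φ₀) c hc).V}
    {w : (fibreProduct ψ c hc).V} {q : List (fibreProduct ψ c hc).E} {l : List Y.E} {y : Y.V}
    (hq : (fibreProduct ψ c hc).IsWalk ((fibreMap φ₀ ψ c hc).onV u) q w)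
    (hl : Y.IsWalk ((fibreFst (ψ.comp φ₀) c hc).onV u) l y)
    (hlq : Z.Homotopic (l.map φ₀.onE) (q.map (fibreFst ψ c hc).onE)) :
    ∃ p v, (fibreProduct (ψ.comp φ₀) c hc).IsWalk u p v ∧
      (fibreProduct ψ c hc).Homotopic (p.map (fibreMap φ₀ ψ c hc).onE) q ∧
      (fibreMap φ₀ ψ c hc).onV v = w ∧ (fibreFst (ψ.comp φ₀) c hc).onV v = y := by
  obtain ⟨p, v, hp, rfl, hv⟩ := (fibreFst_isStarBijective h (ψ.comp φ₀)).exists_lift hl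
  rw [← map_fibreFst_fibreMap] at hlq
  obtain ⟨hpq, hvw⟩ := (fibreFst_isStarBijective h ψ).isStarInjective.homotopic_lift
    (hp.map (fibreMap φ₀ ψ c hc).toHom) hq hlq
  exact ⟨p, v, hp, hpq, hvw, hv⟩

theorem fibreMap_injectiveOnComponents (h₁ : φ₀.toHom.InjectiveOnComponents)
    (h₂ : φ₀.toHom.PiOneSurjective) :
    (fibreMap φ₀ ψ c hc).toHom.InjectiveOnComponents := by
  rintro u w ⟨q, hq⟩
  have hq' := hq.map (fibreFst ψ c hc).toHom
  obtain ⟨p, hp⟩ := h₁ ((fibreFst (ψ.comp φ₀) c hc).onV u)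
    ((fibreFst (ψ.comp φ₀) c hc).onV w) ⟨_, hq'⟩
  -- correct `p` by a loop so that its image becomes homotopic to the projection of `q`
  obtain ⟨l, hl, hlq⟩ := h₂ _ _ (hq'.append (hp.map φ₀.toHom).reversePath)
  obtain ⟨r, v, hr, -, hvw, hv⟩ := exists_lift_homotopic h hq (hl.append hp) (by
    rw [List.map_append]
    refine (hlq.append_right _).trans ?_
    rw [List.append_assoc]
    simpa using (SerreGraph.homotopic_reversePath_append (p.map φ₀.onE)).append_left
      (q.map (fibreFst ψ c hc).onE))
  obtain rfl : v = w :=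
    Subtype.ext (Prod.ext hv (congrArg (fun v => v.1.2) hvw))
  exact ⟨r, hr⟩

theorem fibreMap_piOneSurjective (h₂ : φ₀.toHom.PiOneSurjective) :
    (fibreMap φ₀ ψ c hc).toHom.PiOneSurjective := by
  intro u q hq
  obtain ⟨l, hl, hlq⟩ := h₂ ((fibreFst (ψ.comp φ₀) c hc).onV u) _
    (hq.map (fibreFst ψ c hc).toHom)
  obtain ⟨r, v, hr, hrq, hvw, hv⟩ := exists_lift_homotopic h hq hl hlq
  obtain rfl : v = u :=
    Subtype.ext (Prod.ext hv (congrArg (fun v => v.1.2) hvw))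
  exact ⟨r, hr, hrq⟩

theorem fibreMap_piOneInjective (h₃ : φ₀.toHom.PiOneInjective) :
    (fibreMap φ₀ ψ c hc).toHom.PiOneInjective := by
  intro u p q hp hq hpq
  have hpq' := hpq.map (fibreFst ψ c hc).toHom
  rw [map_fibreFst_fibreMap, map_fibreFst_fibreMap] at hpq'
  exact ((fibreFst_isStarBijective h (ψ.comp φ₀)).isStarInjective.homotopic_lift hp hq
    (h₃ _ _ _ (hp.map (fibreFst (ψ.comp φ₀) c hc).toHom)
      (hq.map (fibreFst (ψ.comp φ₀) c hc).toHom) hpq')).1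

theorem fibreMap_isFolding (hf : (ψ.comp φ₀).IsFolding φ₀ ψ)
    (hp : φ₀.PreservesSkeletonAndFaces) :
    (fibreSnd (ψ.comp φ₀) c hc).IsFolding (fibreMap φ₀ ψ c hc) (fibreSnd ψ c hc) where
  factors := fibreSnd_comp_fibreMap φ₀ ψ c hc
  surjective_onV := by
    rintro ⟨⟨z, x⟩, hzx⟩
    obtain ⟨y, rfl⟩ := hf.surjective_onV z
    exact ⟨⟨(y, x), hzx⟩, rfl⟩
  surjective_onE := by
    rintro ⟨⟨z, x⟩, hzx⟩
    obtain ⟨y, rfl⟩ := hf.surjective_onE z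
    exact ⟨⟨(y, x), hzx⟩, rfl⟩
  surjective_onF := Hom.surjective_onF
    (fibreMap_bijective_onD ψ (Hom.bijective_onD hp.bijective_onF hp.mult_eq_one)).2
  components_injective := fibreMap_injectiveOnComponents h hf.components_injective
    hf.piOne_surjective
  piOne_surjective := fibreMap_piOneSurjective h hf.piOne_surjective
  immersion := fibreSnd_isBranchedImmersion hf.immersion

theorem fibreMap_preservesSkeletonAndFaces (hf : (ψ.comp φ₀).IsFolding φ₀ ψ)
    (hp : φ₀.PreservesSkeletonAndFaces) :
    (fibreMap φ₀ ψ c hc).PreservesSkeletonAndFaces := by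
  have hD := fibreMap_bijective_onD (hc := hc) ψ
    (Hom.bijective_onD hp.bijective_onF hp.mult_eq_one)
  have hf' := fibreMap_isFolding (hc := hc) h hf hp
  refine ⟨⟨hf'.components_injective, fun w => ?_, ?_, hf'.piOne_surjective⟩,
    Hom.bijective_onF hD, Hom.mult_eq_one hD⟩
  · obtain ⟨v, rfl⟩ := hf'.surjective_onV w
    exact ⟨v, [], SerreGraph.IsWalk.nil _⟩
  · exact fibreMap_piOneInjective h hp.homotopyEquiv.piOne_injective

theorem fibreSnd_isEssential {φ : Hom Y X} (hφ : φ.IsEssential) :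
    (fibreSnd φ c hc).IsEssential := by
  obtain ⟨W, φ₀, ψ, hf, hp⟩ := hφ
  obtain rfl := hf.factors
  exact ⟨_, _, _, fibreMap_isFolding h hf hp, fibreMap_preservesSkeletonAndFaces h hf hp⟩

theorem fibreSnd_isEssentialEquiv {φ : Hom Y X} (hφ : φ.IsEssentialEquiv) :
    (fibreSnd φ c hc).IsEssentialEquiv := by
  obtain ⟨W, φ₀, ψ, hf, hp, hi⟩ := hφ
  obtain rfl := hf.factors
  exact ⟨_, _, _, fibreMap_isFolding h hf hp, fibreMap_preservesSkeletonAndFaces h hf hp,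
    fibreSnd_isIso hi⟩

end Lifting

end BranchedComplex

/-! ### Links and branched coverings -/

namespace BranchedComplex

variable {X X' Y : BranchedComplex.{u}}

namespace Hom

variable {c : Hom X' X}

theorem src_onE (c : Hom X' X) (e : X'.E) : X.src (c.onE e) = c.onV (X'.src e) :=
  (c.map_src e).symm

/-- The corners at a vertex of a link upstairs correspond to those at its image. -/
theorem IsBranchedCovering.bijOn_corners (h : c.IsBranchedCovering) (e : X'.E) :
    Set.BijOn c.onD {d | X'.bdry d = e} {d | X.bdry d = c.onE e} := by
  refine ⟨fun d hd => ?_, ?_, fun d hd => ?_⟩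
  · exact (c.map_bdry d).symm.trans (congrArg c.onE hd)
  · refine (h.bijective_corners (X'.src e)).injOn.mono fun d hd => ?_
    exact congrArg X'.src hd
  · obtain ⟨d', hd', rfl⟩ := (h.bijective_corners (X'.src e)).surjOn
      (show X.src (X.bdry d) = _ by rw [hd, c.src_onE])
    refine ⟨d', ?_, rfl⟩
    exact (h.bijective_edges (X'.src e)).injOn hd' rfl ((c.map_bdry d').trans hd)

/-- Paths in links lift along branched coverings. -/
theorem IsBranchedCovering.lift_link (h : c.IsBranchedCovering) (P : X.E → Prop) {e e' : X'.E}
    (he : X'.src e = X'.src e')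
    (hp : Relation.ReflTransGen (fun a b => X.LinkAdj a b ∧ P a ∧ P b) (c.onE e) (c.onE e')) :
    Relation.ReflTransGen (fun a b => X'.LinkAdj a b ∧ P (c.onE a) ∧ P (c.onE b)) e e' := by
  suffices H : ∀ b, Relation.ReflTransGen (fun a b => X.LinkAdj a b ∧ P a ∧ P b) (c.onE e) b →
      ∃ b', X'.src b' = X'.src e ∧ c.onE b' = b ∧ Relation.ReflTransGen
        (fun a b => X'.LinkAdj a b ∧ P (c.onE a) ∧ P (c.onE b)) e b' by
    obtain ⟨b', hb', hbe, hr⟩ := H _ hp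
    rwa [(h.bijective_edges (X'.src e)).injOn hb' he.symm hbe] at hr
  intro b hb
  induction hb with
  | refl => exact ⟨e, rfl, rfl, .refl⟩
  | tail _ hab ih =>
    obtain ⟨a', ha', rfl, hr⟩ := ih
    obtain ⟨⟨d, hd, rfl⟩, hPa, hPb⟩ := hab
    obtain ⟨d', rfl, rfl⟩ := (h.bijOn_corners a').surjOn hd
    have hb := c.map_bdry (X'.opp d')
    rw [c.map_opp] at hb
    exact ⟨X'.bdry (X'.opp d'), (X'.src_bdry_opp d').trans ha', hb,
      hr.tail ⟨⟨d', rfl, rfl⟩, hPa, hb ▸ hPb⟩⟩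

theorem IsBranchedCovering.linkPreconnected (h : c.IsBranchedCovering) {v : X'.V}
    (hv : X.LinkPreconnected (c.onV v)) : X'.LinkPreconnected v := by
  intro e e' he he'
  have hp := hv (c.onE e) (c.onE e') (by rw [c.src_onE, he]) (by rw [c.src_onE, he'])
  have := h.lift_link (fun _ => True) (he.trans he'.symm) (by simpa using hp)
  exact Relation.ReflTransGen.mono (fun _ _ hab => hab.1) _ _ this

theorem IsBranchedCovering.isVisiblyIrreducible (h : c.IsBranchedCovering)
    (hX : X.IsVisiblyIrreducible) : X'.IsVisiblyIrreducible := by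
  obtain ⟨h₁, h₂, h₃, h₄⟩ := hX
  refine ⟨?_, ?_, ?_, ?_⟩
  · rintro ⟨v, hv⟩
    refine h₁ ⟨c.onV v, ?_⟩
    rw [← (h.bijective_edges v).image_eq]
    exact hv.image _
  · rintro ⟨v, hv⟩
    exact h₂ ⟨c.onV v, fun hc => hv (h.linkPreconnected hc)⟩
  · rintro ⟨e, d, hd, hu⟩
    refine h₃ ⟨c.onE e, c.onD d, (h.bijOn_corners e).mapsTo hd, fun b hb => ?_⟩
    obtain ⟨d', hd', rfl⟩ := (h.bijOn_corners e).surjOn hb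
    rw [hu d' hd']
  · rintro ⟨e, e₁, e₂, he₁, he₂, hne₁, hne₂, hr⟩
    have hinj := (h.bijective_edges (X'.src e)).injOn
    refine h₄ ⟨c.onE e, c.onE e₁, c.onE e₂, ?_, ?_, fun hc => hne₁ (hinj he₁ rfl hc),
      fun hc => hne₂ (hinj he₂ rfl hc), fun hc => hr ?_⟩
    · rw [c.src_onE, c.src_onE, he₁]
    · rw [c.src_onE, c.src_onE, he₂]
    · refine Relation.ReflTransGen.mono (fun a b hab => ?_) _ _
        (h.lift_link (fun a => a ≠ c.onE e) (he₁.trans he₂.symm) hc)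
      exact ⟨hab.1, fun hae => hab.2.1 (congrArg c.onE hae),
        fun hbe => hab.2.2 (congrArg c.onE hbe)⟩

theorem IsBranchedCovering.isSurface (h : c.IsBranchedCovering) (hX' : X'.IsFinite)
    (hX : X.IsSurface) : X'.IsSurface where
  finite := hX'
  link_nonempty v := by
    obtain ⟨e, he⟩ := hX.link_nonempty (c.onV v)
    obtain ⟨e', he', -⟩ := (h.bijective_edges v).surjOn he
    exact ⟨e', he'⟩
  link_connected v := h.linkPreconnected (hX.link_connected _)
  link_valence e := by
    rw [← hX.link_valence (c.onE e), ← (h.bijOn_corners e).image_eq,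
      (h.bijOn_corners e).injOn.ncard_image]

/-- Finite branched coverings of irreducible complexes are irreducible: a visibly irreducible
model can be pulled back. -/
theorem IsBranchedCovering.isIrreducible (h : c.IsBranchedCovering)
    (hc : Function.Surjective c.onD) (hX' : X'.IsFinite) (hX : X.IsIrreducible) :
    X'.IsIrreducible := by
  obtain ⟨W, φ, hW, hWi, hφ⟩ := hX
  exact ⟨fibreProduct φ c hc, fibreSnd φ c hc, fibreProduct_isFinite hW hX',
    (fibreFst_isBranchedCovering φ h).isVisiblyIrreducible hWi, fibreSnd_isEssentialEquiv h hφ⟩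

/-! ### Curvature and branched coverings -/

/-- Over an edge there are as many edges as there are vertices over its initial vertex. -/
theorem IsBranchedCovering.card_edge_fibre (h : c.IsBranchedCovering) (e : X.E) :
    Nat.card {e' // c.onE e' = e} = Nat.card {v // c.onV v = X.src e} := by
  refine Nat.card_eq_of_bijective (fun e' => ⟨X'.src e', by rw [c.map_src, e'.2]⟩) ⟨?_, ?_⟩
  · rintro ⟨a, ha⟩ ⟨b, hb⟩ hab
    exact Subtype.ext ((h.bijective_edges (X'.src b)).injOn (congrArg Subtype.val hab) rfl
      (ha.trans hb.symm))
  · rintro ⟨v, hv⟩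
    obtain ⟨e', rfl, he'⟩ := (h.bijective_edges v).surjOn hv.symm
    exact ⟨⟨e', he'⟩, rfl⟩

theorem IsBranchedCovering.card_side_fibre (h : c.IsBranchedCovering) (d : X.D) :
    Nat.card {d' // c.onD d' = d} = Nat.card {v // c.onV v = X.src (X.bdry d)} := by
  refine Nat.card_eq_of_bijective
    (fun d' => ⟨X'.src (X'.bdry d'), by rw [c.map_src, c.map_bdry, d'.2]⟩) ⟨?_, ?_⟩
  · rintro ⟨a, ha⟩ ⟨b, hb⟩ hab
    exact Subtype.ext ((h.bijective_corners (X'.src (X'.bdry b))).injOn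
      (congrArg Subtype.val hab) rfl (ha.trans hb.symm))
  · rintro ⟨v, hv⟩
    obtain ⟨d', rfl, hd'⟩ := (h.bijective_corners v).surjOn hv.symm
    exact ⟨⟨d', hd'⟩, rfl⟩

/-- The number of sheets is constant along edges. -/
theorem IsBranchedCovering.card_fibre_src_eq (h : c.IsBranchedCovering) (e : X.E) :
    Nat.card {v // c.onV v = X.src e} = Nat.card {v // c.onV v = X.src (X.inv e)} := by
  rw [← h.card_edge_fibre, ← h.card_edge_fibre]
  have hX' : Function.Involutive X'.inv := X'.inv_inv
  refine Nat.card_congr (hX'.toPerm.subtypeEquiv fun a => ?_)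
  rw [hX'.coe_toPerm, c.map_inv]
  exact ⟨fun h => by rw [h], fun h => by rw [← X.inv_inv (c.onE a), h, X.inv_inv]⟩

end Hom

theorem totalArea_eq_sum_density [Fintype X.D] (hX : X.IsFinite) :
    (X.totalArea : ℚ) = ∑ d, X.density d := by
  classical
  have := hX.finite_F
  have := Fintype.ofFinite X.F
  rw [totalArea, finsum_eq_sum_of_fintype, Nat.cast_sum,
    ← Finset.sum_fiberwise (s := Finset.univ) (g := X.face)]
  refine Finset.sum_congr rfl fun f _ => ?_
  have hcard : (Finset.univ.filter fun d => X.face d = f).card = X.numSides f := by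
    rw [numSides, Nat.card_eq_fintype_card, Fintype.card_subtype]
  rw [Finset.sum_congr rfl (g := fun _ => (X.area f / X.numSides f : ℚ)), Finset.sum_const,
    hcard, nsmul_eq_mul, mul_div_cancel₀]
  · exact_mod_cast (numSides_pos f).ne'
  · intro d hd
    rw [density, (Finset.mem_filter.1 hd).2]

theorem totalArea_pos (hX : X.IsFinite) : 0 < X.totalArea := by
  have := hX.finite_F
  have := Fintype.ofFinite X.F
  have := X.nonempty_F
  rw [totalArea, finsum_eq_sum_of_fintype]
  exact Finset.sum_pos (fun f _ => X.area_pos f) Finset.univ_nonempty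

namespace Hom

variable {c : Hom X' X} {N : ℕ}

theorem IsBranchedCovering.totalArea_eq (h : c.IsBranchedCovering) (hX' : X'.IsFinite)
    (hX : X.IsFinite) (hN : ∀ v, Nat.card {v' // c.onV v' = v} = N) :
    X'.totalArea = N * X.totalArea := by
  classical
  have := finite_sides hX'
  have := finite_sides hX
  have := Fintype.ofFinite X'.D
  have := Fintype.ofFinite X.D
  have key : (X'.totalArea : ℚ) = N * X.totalArea := by
    rw [totalArea_eq_sum_density hX', totalArea_eq_sum_density hX, Finset.mul_sum,
      ← Finset.sum_fiberwise (s := Finset.univ) (g := c.onD)]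
    refine Finset.sum_congr rfl fun d _ => ?_
    have hcard : (Finset.univ.filter fun d' => c.onD d' = d).card = N := by
      rw [← hN (X.src (X.bdry d)), ← h.card_side_fibre d, Nat.card_eq_fintype_card,
        Fintype.card_subtype]
    rw [Finset.sum_congr rfl (g := fun _ => X.density d), Finset.sum_const, hcard, nsmul_eq_mul]
    intro d' hd'
    rw [← c.density_onD, (Finset.mem_filter.1 hd').2]
  exact_mod_cast key

theorem IsBranchedCovering.skeletonEuler_eq (h : c.IsBranchedCovering) (hX' : X'.IsFinite)
    (hX : X.IsFinite) (hN : ∀ v, Nat.card {v' // c.onV v' = v} = N) :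
    X'.skeletonEuler = N * X.skeletonEuler := by
  have := hX.finite_V
  have := hX.finite_E
  have := hX'.finite_V
  have := hX'.finite_E
  have hV := Nat.card_eq_mul_of_card_fibre c.onV N hN
  have hE := Nat.card_eq_mul_of_card_fibre c.onE N fun e => by rw [h.card_edge_fibre, hN]
  rw [skeletonEuler, skeletonEuler, hV, hE]
  push_cast
  ring

/-- Area and the Euler characteristic of the 1-skeleton are both multiplied by the degree, so that
the average curvature does not change. -/
theorem IsBranchedCovering.averageCurvature_eq (h : c.IsBranchedCovering) (hX' : X'.IsFinite)
    (hX : X.IsFinite) (hN : ∀ v, Nat.card {v' // c.onV v' = v} = N) :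
    X'.averageCurvature = X.averageCurvature := by
  have hA := h.totalArea_eq hX' hX hN
  have hN₀ : (N : ℝ) ≠ 0 := by
    rintro h₀
    have := totalArea_pos hX'
    rw [hA, Nat.cast_eq_zero.1 h₀, zero_mul] at this
    exact this.ne' rfl
  rw [averageCurvature, averageCurvature, totalCurvature, totalCurvature, hA,
    h.skeletonEuler_eq hX' hX hN]
  push_cast
  rw [← mul_add, mul_div_mul_left _ _ hN₀]

end Hom

theorem card_fibreFst_fibre (φ : Hom Y X) (c : Hom X' X) (hc : Function.Surjective c.onD)
    (y : Y.V) :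
    Nat.card {v // (fibreFst φ c hc).onV v = y} = Nat.card {x // c.onV x = φ.onV y} := by
  refine Nat.card_eq_of_bijective
    (fun v => ⟨v.1.1.2, v.1.2.symm.trans (congrArg φ.onV v.2)⟩) ⟨?_, ?_⟩
  · rintro ⟨⟨⟨y₁, x₁⟩, h₁⟩, rfl⟩ ⟨⟨⟨y₂, x₂⟩, h₂⟩, h⟩ hx
    obtain rfl : y₂ = y₁ := h
    obtain rfl : x₁ = x₂ := congrArg Subtype.val hx
    rfl
  · rintro ⟨x, hx⟩
    exact ⟨⟨⟨(y, x), hx.symm⟩, rfl⟩, rfl⟩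

/-! ### Coverings of constant degree -/

/-- The data over `X` of the disjoint union that contains `w v` copies of the component of each
vertex `v`, for a locally constant function `w`. -/
def copiesData (X : BranchedComplex.{u}) (w : X.V → ℕ) (hpos : ∀ v, 0 < w v)
    (hw : ∀ e, w (X.src e) = w (X.src (X.inv e))) : SideData X where
  G :=
    { V := {p : X.V × ℕ // p.2 < w p.1}
      E := {p : X.E × ℕ // p.2 < w (X.src p.1)}
      src := fun e => ⟨(X.src e.1.1, e.1.2), e.2⟩
      inv := fun e => ⟨(X.inv e.1.1, e.1.2), by rw [← hw]; exact e.2⟩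
      inv_inv := fun e => Subtype.ext (Prod.ext (X.inv_inv _) rfl)
      inv_ne := fun e h => X.inv_ne e.1.1 (congrArg (fun e => e.1.1) h) }
  toGraphHom :=
    { onV := fun v => v.1.1
      onE := fun e => e.1.1
      map_src := fun _ => rfl
      map_inv := fun _ => rfl }
  D := {p : X.D × ℕ // p.2 < w (X.src (X.bdry p.1))}
  rev d := ⟨(X.rev d.1.1, d.1.2), by rw [X.bdry_rev, ← hw]; exact d.2⟩
  opp d := ⟨(X.opp d.1.1, d.1.2), by rw [X.src_bdry_opp]; exact d.2⟩
  bdry d := ⟨(X.bdry d.1.1, d.1.2), d.2⟩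
  onD d := d.1.1
  rev_rev d := Subtype.ext (Prod.ext (X.rev_rev _) rfl)
  opp_opp d := Subtype.ext (Prod.ext (X.opp_opp _) rfl)
  bdry_rev d := Subtype.ext (Prod.ext (X.bdry_rev _) rfl)
  src_bdry_opp d := Subtype.ext (Prod.ext (X.src_bdry_opp _) rfl)
  map_rev _ := rfl
  map_opp _ := rfl
  map_bdry _ := rfl
  orbit_finite d := by
    have h₁ : {a | X.face a = X.face d.1.1}.Finite := Set.finite_coe_iff.1 (X.face_finite _)
    refine ((h₁.prod (Set.finite_singleton d.1.2)).preimage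
      Subtype.val_injective.injOn).subset fun d' h => ?_
    induction h with
    | refl => exact ⟨rfl, rfl⟩
    | tail _ h ih =>
      rcases h with rfl | rfl
      · exact ⟨(X.face_rev _).trans ih.1, ih.2⟩
      · exact ⟨(X.face_opp _).trans ih.1, ih.2⟩
  nonempty_D := by
    obtain ⟨f⟩ := X.nonempty_F
    obtain ⟨d, -⟩ := X.face_surjective f
    exact ⟨⟨(d, 0), hpos _⟩⟩

section Copies

variable {w : X.V → ℕ} {hpos : ∀ v, 0 < w v} {hw : ∀ e, w (X.src e) = w (X.src (X.inv e))}

theorem copies_isBranchedCovering : (copiesData X w hpos hw).proj.IsBranchedCovering := by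
  constructor
  · rintro ⟨⟨v, i⟩, hv⟩
    refine ⟨?_, ?_, ?_⟩
    · intro e he
      exact congrArg (fun v => v.1.1) he
    · rintro ⟨⟨e, j⟩, hj⟩ he ⟨⟨e', j'⟩, hj'⟩ he' (rfl : e = e')
      obtain rfl : j = j' := congrArg (fun v => v.1.2) (he.trans he'.symm)
      rfl
    · rintro e (rfl : X.src e = v)
      exact ⟨⟨(e, i), hv⟩, rfl, rfl⟩
  · rintro ⟨⟨v, i⟩, hv⟩
    refine ⟨?_, ?_, ?_⟩
    · intro e he
      exact congrArg (fun v => v.1.1) he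
    · rintro ⟨⟨e, j⟩, hj⟩ he ⟨⟨e', j'⟩, hj'⟩ he' (rfl : e = e')
      obtain rfl : j = j' := congrArg (fun v => v.1.2) (he.trans he'.symm)
      rfl
    · rintro d (rfl : X.src (X.bdry d) = v)
      exact ⟨⟨(d, i), hv⟩, rfl, rfl⟩

theorem copies_surjective_onV : Function.Surjective (copiesData X w hpos hw).proj.onV :=
  fun v => ⟨⟨(v, 0), hpos v⟩, rfl⟩

theorem copies_isFinite (hX : X.IsFinite) : (copiesData X w hpos hw).complex.IsFinite := by
  have := hX.finite_V
  have := hX.finite_E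
  have := finite_sides hX
  -- an injection into pairs of an element of `X` and the number of a copy, which is bounded
  have key : ∀ {α : Type u} [Finite α] (b : α → ℕ), Finite {p : α × ℕ // p.2 < b p.1} := by
    intro α _ b
    refine Finite.of_injective
      (fun p : {p : α × ℕ // p.2 < b p.1} => (⟨p.1.1, p.1.2, p.2⟩ : Σ a, Fin (b a))) ?_
    rintro ⟨⟨a, i⟩, hi⟩ ⟨⟨a', i'⟩, hi'⟩ h
    obtain ⟨rfl, h⟩ := Sigma.mk.inj_iff.1 h
    obtain rfl : i = i' := congrArg Fin.val (eq_of_heq h)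
    rfl
  have : Finite (copiesData X w hpos hw).complex.D := key fun d => w (X.src (X.bdry d))
  exact
    { finite_V := key w
      finite_E := key fun e => w (X.src e)
      finite_F := Finite.of_surjective _ (copiesData X w hpos hw).complex.face_surjective }

end Copies

/-- If `X'` is a finite-sheeted branched covering of `X`, then suitable numbers of copies of the
components of `X'` make up a branched covering of `X` of constant degree. -/
theorem exists_isBranchedCovering_of_constant_degree {φ : Hom X' X}
    (hφ : φ.IsFiniteSheetedBranchedCovering) (hX : X.IsFinite) (hX' : X'.IsFinite) :
    ∃ (X'' : BranchedComplex.{u}) (χ : Hom X'' X') (N : ℕ), X''.IsFinite ∧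
      χ.IsBranchedCovering ∧ Function.Surjective (φ.comp χ).onV ∧
      ∀ v, Nat.card {v' // (φ.comp χ).onV v' = v} = N := by
  have := hX.finite_V
  have := Fintype.ofFinite X.V
  have := hX'.finite_V
  let deg : X.V → ℕ := fun v => Nat.card {v' // φ.onV v' = v}
  have hdeg : ∀ v, 0 < deg v := fun v =>
    have : Nonempty {v' // φ.onV v' = v} := (hφ.fibre_nonempty v).to_subtype
    Nat.card_pos
  let N := ∏ v, deg v
  have hN : 0 < N := Finset.prod_pos fun v _ => hdeg v
  have hdvd : ∀ v, deg v ∣ N := fun v => Finset.dvd_prod_of_mem deg (Finset.mem_univ v)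
  -- a component of `X'` over a component of `X` of degree `n` is taken `N / n` times
  let w : X'.V → ℕ := fun v' => N / deg (φ.onV v')
  have hpos : ∀ v', 0 < w v' := fun v' => Nat.div_pos (Nat.le_of_dvd hN (hdvd _)) (hdeg _)
  have hw : ∀ e, w (X'.src e) = w (X'.src (X'.inv e)) := fun e => by
    simp only [w, deg, φ.map_src, φ.map_inv]
    rw [hφ.card_fibre_src_eq]
  refine ⟨_, (copiesData X' w hpos hw).proj, N, copies_isFinite hX', copies_isBranchedCovering,
    fun v => ?_, fun v => ?_⟩
  · obtain ⟨v', rfl⟩ := hφ.fibre_nonempty v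
    obtain ⟨v'', rfl⟩ := copies_surjective_onV (hpos := hpos) (hw := hw) v'
    exact ⟨v'', rfl⟩
  · have h : Nat.card {v' // φ.onV v' = v} * (N / deg v) = N := Nat.mul_div_cancel' (hdvd v)
    rw [← h, ← Nat.card_fin (N / deg v), ← Nat.card_prod]
    refine (Nat.card_eq_of_bijective
      (fun p : {v' // φ.onV v' = v} × Fin (N / deg v) =>
        (⟨⟨(p.1.1, p.2.1), by simp only [w]; rw [p.1.2]; exact p.2.2⟩, p.1.2⟩ :
          {v' // (φ.comp (copiesData X' w hpos hw).proj).onV v' = v})) ⟨?_, ?_⟩).symm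
    · rintro ⟨⟨v', hv'⟩, i⟩ ⟨⟨v'', hv''⟩, i'⟩ hii
      obtain ⟨h₁, h₂⟩ := Prod.mk.inj (congrArg (fun p => p.1.1) hii)
      exact Prod.ext (Subtype.ext h₁) (Fin.ext h₂)
    · rintro ⟨⟨⟨v', i⟩, hi⟩, rfl⟩
      exact ⟨⟨⟨v', rfl⟩, ⟨i, hi⟩⟩, rfl⟩

/-! ### Invariance of the curvature bounds -/

/-- If a property of complexes passes to finite branched coverings, then the complexes with this
property have the same average curvatures over `X'` as over `X`. -/
theorem curvatures_eq_of_isFiniteSheetedBranchedCovering {φ : Hom X' X}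
    (hφ : φ.IsFiniteSheetedBranchedCovering) (hX : X.IsFinite) (hX' : X'.IsFinite)
    (P : BranchedComplex.{u} → Prop) (hfin : ∀ Y, P Y → Y.IsFinite)
    (hP : ∀ (Y Y' : BranchedComplex.{u}) (c : Hom Y' Y), c.IsBranchedCovering →
      Function.Surjective c.onD → Y'.IsFinite → P Y → P Y') :
    {k : EReal | ∃ Y : BranchedComplex.{u}, P Y ∧ (∃ ψ : Hom Y X', ψ.IsEssential) ∧
      k = (Y.averageCurvature : EReal)} =
    {k : EReal | ∃ Y : BranchedComplex.{u}, P Y ∧ (∃ ψ : Hom Y X, ψ.IsEssential) ∧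
      k = (Y.averageCurvature : EReal)} := by
  ext k
  constructor
  · rintro ⟨Y, hY, ⟨ψ, hψ⟩, rfl⟩
    exact ⟨Y, hY, ⟨φ.comp ψ, hψ.comp hφ.isBranchedImmersion⟩, rfl⟩
  · rintro ⟨Y, hY, ⟨ψ, hψ⟩, rfl⟩
    obtain ⟨X'', χ, N, hX'', hχ, hsurj, hN⟩ :=
      exists_isBranchedCovering_of_constant_degree hφ hX hX'
    have hc : (φ.comp χ).IsBranchedCovering := hφ.toIsBranchedCovering.comp hχ
    have hcD := hc.surjective_onD hsurj
    have hfst := fibreFst_isBranchedCovering (hc := hcD) ψ hc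
    have hfstV : Function.Surjective (fibreFst ψ (φ.comp χ) hcD).onV := fun y => by
      obtain ⟨x, hx⟩ := hsurj (ψ.onV y)
      exact ⟨⟨(y, x), hx.symm⟩, rfl⟩
    have hfinite : (fibreProduct ψ (φ.comp χ) hcD).IsFinite :=
      fibreProduct_isFinite (hfin Y hY) hX''
    refine ⟨fibreProduct ψ (φ.comp χ) hcD,
      hP _ _ _ hfst (hfst.surjective_onD hfstV) hfinite hY,
      ⟨χ.comp (fibreSnd ψ (φ.comp χ) hcD),
        (fibreSnd_isEssential hc hψ).comp hχ.isBranchedImmersion⟩, ?_⟩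
    rw [hfst.averageCurvature_eq hfinite (hfin Y hY) fun y => by
      rw [card_fibreFst_fibre, hN]]

end BranchedComplex

theorem mainTheorem7 (X' X : BranchedComplex.{u})
    (hX'fin : X'.IsFinite) (hX'irr : X'.IsIrreducible)
    (hXfin : X.IsFinite) (hXirr : X.IsIrreducible)
    (φ : BranchedComplex.Hom X' X) (hφ : φ.IsFiniteSheetedBranchedCovering) :
    X'.rhoPlus = X.rhoPlus ∧ X'.rhoMinus = X.rhoMinus ∧
      X'.sigmaPlus = X.sigmaPlus ∧ X'.sigmaMinus = X.sigmaMinus := by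
  have hρ : X'.irreducibleCurvatures = X.irreducibleCurvatures := by
    have h := BranchedComplex.curvatures_eq_of_isFiniteSheetedBranchedCovering hφ hXfin hX'fin
      (fun Y => Y.IsFinite ∧ Y.IsIrreducible) (fun _ h => h.1)
      (fun _ _ _ hc hD hfin h => ⟨hfin, hc.isIrreducible hD hfin h.2⟩)
    simp only [and_assoc] at h
    exact h
  have hσ : X'.surfaceCurvatures = X.surfaceCurvatures :=
    BranchedComplex.curvatures_eq_of_isFiniteSheetedBranchedCovering hφ hXfin hX'fin
      BranchedComplex.IsSurface (fun _ h => h.finite)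
      (fun _ _ _ hc _ hfin h => hc.isSurface hfin h)
  simp only [BranchedComplex.rhoPlus, BranchedComplex.rhoMinus, BranchedComplex.sigmaPlus,
    BranchedComplex.sigmaMinus, hρ, hσ, and_self]
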